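/- **Theorem 3.1.** Let $\mathcal H,\hat{\mathcal H}$ be complex Hilbert spaces and $\tilde{\mathcal H}=\mathcal H\oplus\hat{\mathcal H}$. Let $T_a$ be a self-adjoint operator in $\mathcal H$ bounded from below by $\eta\in\mathbb R$, i.e. $\langle T_au,u\rangle\ge\eta\|u\|^2$ for $u\in\operatorname{dom}T_a$. Let $D$ be a self-adjoint operator in $\hat{\mathcal H}$, and let $B:\hat{\mathcal H}\to\mathcal H$ be a densely defined closed operator such that $\operatorname{dom}B\subset\operatorname{dom}D$, $\operatorname{dom}B$ is a core of $D$, and $\operatorname{dom}|T_a|^{1/2}\subset\operatorname{dom}B^*$. For $\lambda\in\mathbb C$ define, on their natural domains, $$P(\lambda)=\begin{bmatrix}T_a+\lambda^2&B\\B^*&D+\lambda\end{bmatrix}\ \text{in }\tilde{\mathcal H},\qquad \tilde T(\lambda)=\begin{bmatrix}-\lambda&-T_a&-B\\ I&-\lambda&0\\0&B^*&D+\lambda\end{bmatrix}\ \text{in }\mathcal H\oplus\tilde{\mathcal H},$$ $$\mathcal A=\begin{bmatrix}T_a&B\\B^*&D\end{bmatrix},\qquad \mathcal B(\lambda)=\begin{bmatrix}\lambda^2&0\\0&\lambda\end{bmatrix}\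 \text{in }\tilde{\mathcal H}.$$ (The natural domain of a block operator matrix consists of the vectors whose every component lies in the domains of all entries of the corresponding column.) Then: 1. $P(\lambda)$ and $\tilde T(\lambda)$ are closable for every $\lambda\in\mathbb C$. 2. $\mathcal A$ is upper dominant, i.e. $B^*$ is $T_a$-bounded and $D$ is $B$-bounded. Moreover $\mathcal A$ is closable, its closure $\overline{\mathcal A}$ is self-adjoint, and $\overline{P(\lambda)}=\overline{\mathcal A}+\mathcal B(\lambda)$ with domain $\operatorname{dom}\overline{\mathcal A}$, for every $\lambda\in\mathbb C$. 3. Every real $\mu<\eta$ belongs to the resolvent set of $T_a$. For every real $\mu$ in the resolvent set of $T_a$, the operator $(T_a-\mu)^{-1}B$ is closable, its closure $G_\mu=\overline{(T_a-\mu)^{-1}B}$ is a bounded operator defined on all of $\hat{\mathcal H}$, and $$\operatorname{dom}\overline{\mathcal A}=\left\{\begin{bmatrix}u\\v\end{bmatrix}\in\tilde{\mathcal H}\,:\,v\in\operatorname{dom}D,\ u+G_\mu v\in\operatorname{dom}T_a\right\}.$$ For every such $(u,v)$ one has $u\in\operatorname{dom}B^*$ and $$\overline{\mathcal A}\begin{bmatrix}u\\v\end{bmatrix}=\begin{bmatrix}T_a(u+G_\mu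 v)-\mu\,G_\mu v\\B^*u+Dv\end{bmatrix}.$$ -/

import Mathlib

open scoped InnerProductSpace

namespace BlockOp

/-- Composition `g ∘ f` of unbounded operators on its natural domain
`{x ∈ dom f | f x ∈ dom g}`. -/
def natComp {E F G : Type*} [AddCommGroup E] [Module ℂ E] [AddCommGroup F] [Module ℂ F]
    [AddCommGroup G] [Module ℂ G] (g : F →ₗ.[ℂ] G) (f : E →ₗ.[ℂ] F) : E →ₗ.[ℂ] G where
  domain :=
    { carrier := {x | ∃ h : x ∈ f.domain, f ⟨x, h⟩ ∈ g.domain}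
      zero_mem' := ⟨f.domain.zero_mem, by
        have h : f ⟨0, f.domain.zero_mem⟩ = 0 := f.map_zero
        rw [h]; exact g.domain.zero_mem⟩
      add_mem' := by
        rintro x y ⟨hx, hx'⟩ ⟨hy, hy'⟩
        refine ⟨f.domain.add_mem hx hy, ?_⟩
        have h := f.map_add ⟨x, hx⟩ ⟨y, hy⟩
        have h' := g.domain.add_mem hx' hy'
        rw [← h] at h'; exact h'
      smul_mem' := by
        rintro c x ⟨hx, hx'⟩
        refine ⟨f.domain.smul_mem c hx, ?_⟩
        have h := f.map_smul c ⟨x, hx⟩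
        have h' := g.domain.smul_mem c hx'
        rw [← h] at h'; exact h' }
  toFun :=
    { toFun := fun x => g ⟨f ⟨x, x.2.1⟩, x.2.2⟩
      map_add' := by
        intro x y
        rw [← g.map_add]
        congr 1
        exact Subtype.ext (f.map_add ⟨x, x.2.1⟩ ⟨y, y.2.1⟩)
      map_smul' := by
        intro c x
        rw [RingHom.id_apply, ← g.map_smul]
        congr 1
        exact Subtype.ext (f.map_smul c ⟨x, x.2.1⟩) }

section Entries

variable {E F G : Type*}
  [NormedAddCommGroup E] [InnerProductSpace ℂ E]
  [NormedAddCommGroup F] [InnerProductSpace ℂ F]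
  [NormedAddCommGroup G] [InnerProductSpace ℂ G]

variable (E) in
/-- The everywhere defined operator `x ↦ c x`. -/
noncomputable def scalarOp (c : ℂ) : E →ₗ.[ℂ] E := (c • (LinearMap.id : E →ₗ[ℂ] E)).toPMap ⊤

/-- The row `[f g] : E ⊕ F → G`, `(x, y) ↦ f x + g y`, with domain `dom f ⊕ dom g`; the
orthogonal sum `E ⊕ F` is `WithLp 2 (E × F)`. -/
noncomputable def opRow (f : E →ₗ.[ℂ] G) (g : F →ₗ.[ℂ] G) : WithLp 2 (E × F) →ₗ.[ℂ] G where
  domain :=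
    { carrier := {x | x.fst ∈ f.domain ∧ x.snd ∈ g.domain}
      zero_mem' := ⟨f.domain.zero_mem, g.domain.zero_mem⟩
      add_mem' := fun hx hy => ⟨f.domain.add_mem hx.1 hy.1, g.domain.add_mem hx.2 hy.2⟩
      smul_mem' := fun c _ hx => ⟨f.domain.smul_mem c hx.1, g.domain.smul_mem c hx.2⟩ }
  toFun :=
    { toFun := fun x => f ⟨x.1.fst, x.2.1⟩ + g ⟨x.1.snd, x.2.2⟩
      map_add' := by
        intro x y
        have h1 := f.map_add ⟨x.1.fst, x.2.1⟩ ⟨y.1.fst, y.2.1⟩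
        have h2 := g.map_add ⟨x.1.snd, x.2.2⟩ ⟨y.1.snd, y.2.2⟩
        rw [add_add_add_comm, ← h1, ← h2]; rfl
      map_smul' := by
        intro c x
        have h1 := f.map_smul c ⟨x.1.fst, x.2.1⟩
        have h2 := g.map_smul c ⟨x.1.snd, x.2.2⟩
        rw [RingHom.id_apply, smul_add, ← h1, ← h2]; rfl }

/-- The column `[f; g] : E → F ⊕ G`, `x ↦ (f x, g x)`, with domain `dom f ∩ dom g`. -/
noncomputable def opCol (f : E →ₗ.[ℂ] F) (g : E →ₗ.[ℂ] G) : E →ₗ.[ℂ] WithLp 2 (F × G) where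
  domain := f.domain ⊓ g.domain
  toFun :=
    { toFun := fun x => WithLp.toLp 2 (f ⟨x, x.2.1⟩, g ⟨x, x.2.2⟩)
      map_add' := by
        intro x y
        have h1 := f.map_add ⟨x, x.2.1⟩ ⟨y, y.2.1⟩
        have h2 := g.map_add ⟨x, x.2.2⟩ ⟨y, y.2.2⟩
        rw [← WithLp.toLp_add, Prod.mk_add_mk, ← h1, ← h2]; rfl
      map_smul' := by
        intro c x
        have h1 := f.map_smul c ⟨x, x.2.1⟩
        have h2 := g.map_smul c ⟨x, x.2.2⟩
        rw [RingHom.id_apply, ← WithLp.toLp_smul, Prod.smul_mk, ← h1, ← h2]; rfl }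

/-- The block operator matrix `[[a, b], [c, d]]` in `E ⊕ F` with its natural domain
`(dom a ∩ dom c) ⊕ (dom b ∩ dom d)`. -/
noncomputable def opBlock (a : E →ₗ.[ℂ] E) (b : F →ₗ.[ℂ] E) (c : E →ₗ.[ℂ] F) (d : F →ₗ.[ℂ] F) :
    WithLp 2 (E × F) →ₗ.[ℂ] WithLp 2 (E × F) :=
  opCol (opRow a b) (opRow c d)

/-- `T ≥ η`, that is, `⟨T u, u⟩ ≥ η ‖u‖²` for all `u ∈ dom T`. -/
def IsBoundedBelow (T : E →ₗ.[ℂ] E) (η : ℝ) : Prop :=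
  ∀ u : T.domain, η * ‖(u : E)‖ ^ 2 ≤ (⟪T u, (u : E)⟫_ℂ).re

/-- `g` is `f`-bounded: `dom f ⊆ dom g` and `‖g x‖ ≤ a ‖x‖ + b ‖f x‖` on `dom f`. -/
def IsRelBounded (g : E →ₗ.[ℂ] F) (f : E →ₗ.[ℂ] G) : Prop :=
  ∃ h : f.domain ≤ g.domain, ∃ a b : ℝ, 0 ≤ a ∧ 0 ≤ b ∧
    ∀ x : f.domain, ‖g ⟨x, h x.2⟩‖ ≤ a * ‖(x : E)‖ + b * ‖f x‖

/-- `R` is the bounded, everywhere defined inverse of the operator `T`. -/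
def IsBoundedInverse (T : E →ₗ.[ℂ] E) (R : E →L[ℂ] E) : Prop :=
  (∀ x : T.domain, R (T x) = x) ∧ ∀ y : E, ∃ h : R y ∈ T.domain, T ⟨R y, h⟩ = y

end Entries

section Roots

variable {E : Type*} [NormedAddCommGroup E] [InnerProductSpace ℂ E] [CompleteSpace E]

/-- `S` is a non-negative self-adjoint operator with `S ^ 2 = A`, equality of domains included. -/
def IsPosSqrt (A S : E →ₗ.[ℂ] E) : Prop :=
  IsSelfAdjoint S ∧ IsBoundedBelow S 0 ∧ natComp S S = A

open Classical in
/-- The square root `A ^ (1/2)` of a non-negative self-adjoint operator `A`: the unique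
non-negative self-adjoint `S` with `S ^ 2 = A`. Such an `S` exists for every non-negative
self-adjoint `A`; for other `A` the value is irrelevant. -/
noncomputable def posSqrt (A : E →ₗ.[ℂ] E) : E →ₗ.[ℂ] E :=
  if h : ∃ S, IsPosSqrt A S then h.choose else 0

/-- The absolute value `|T| = (T* T) ^ (1/2)`. -/
noncomputable def absOp (T : E →ₗ.[ℂ] E) : E →ₗ.[ℂ] E := posSqrt (natComp T.adjoint T)

/-- `|T| ^ (1/2)`. -/
noncomputable def sqrtAbsOp (T : E →ₗ.[ℂ] E) : E →ₗ.[ℂ] E := posSqrt (absOp T)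

end Roots

section Functions

variable {H K : Type*}
  [NormedAddCommGroup H] [InnerProductSpace ℂ H]
  [NormedAddCommGroup K] [InnerProductSpace ℂ K] [CompleteSpace K]

/-- The block operator matrix `[[Ta, B], [B*, D]]`. -/
noncomputable def opA (Ta : H →ₗ.[ℂ] H) (B : K →ₗ.[ℂ] H) (D : K →ₗ.[ℂ] K) :
    WithLp 2 (H × K) →ₗ.[ℂ] WithLp 2 (H × K) :=
  opBlock Ta B B.adjoint D

/-- The operator function `P(z) = [[Ta + z², B], [B*, D + z]]`. -/
noncomputable def opP (Ta : H →ₗ.[ℂ] H) (B : K →ₗ.[ℂ] H) (D : K →ₗ.[ℂ] K) (z : ℂ) :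
    WithLp 2 (H × K) →ₗ.[ℂ] WithLp 2 (H × K) :=
  opBlock (Ta + scalarOp H (z ^ 2)) B B.adjoint (D + scalarOp K z)

/-- The linearized operator function in `H ⊕ (H ⊕ K)`,
`[[-z, -Ta, -B], [1, -z, 0], [0, B*, D + z]]`, with its natural domain. -/
noncomputable def opTt (Ta : H →ₗ.[ℂ] H) (B : K →ₗ.[ℂ] H) (D : K →ₗ.[ℂ] K) (z : ℂ) :
    WithLp 2 (H × WithLp 2 (H × K)) →ₗ.[ℂ] WithLp 2 (H × WithLp 2 (H × K)) :=
  opCol (opRow (scalarOp H (-z)) (opRow (-Ta) (-B)))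
    (opCol (opRow (scalarOp H 1) (opRow (scalarOp H (-z)) 0))
      (opRow 0 (opRow B.adjoint (D + scalarOp K z))))

end Functions

end BlockOp

/-! The engine is a form bound `‖B* u‖² ≤ C (⟨Ta u, u⟩ - ν ‖u‖²)` on `dom Ta`, with `ν = η - 1`
(`exists_form_bound`). By the closed graph theorem `B*` is bounded relative to `|Ta|^(1/2)`, and
`‖|Ta|^(1/2) u‖² = ⟨|Ta| u, u⟩`. Since `|Ta|² = Ta²`, the operator `|Ta|` is bounded relative to `Ta
- ν`, and Heinz's inequality (`re_inner_le_of_norm_apply_le`) turns this operator bound into a bound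
of forms.

Let `S = (Ta - ν)⁻¹`. Then `B* S` is bounded, so its adjoint `J` is a bounded extension of `S B`
(`exists_resolvent_comp`). Evaluating the form bound at `J v` for `v ∈ dom B` shows that `W = B* J`
is bounded and symmetric (`exists_adjoint_comp`). This allows the block matrix to be factored
through the Schur complement `D - W`: the resulting `schurOp` is self-adjoint, because in the
coordinates `w = u + J v` and `v` its diagonal part is `Ta - ν` and a bounded symmetric perturbation
of `D`. It extends `𝒜`, and because `dom B` is a core of `D` it is the closure of `𝒜`
(`closure_opA_eq_schurOp`).

The rest follows from this. `P(λ)` differs from `𝒜` by a bounded diagonal operator. Closability of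
`T̃(λ)` is read off row by row. The first resolvent identity carries the description of the closure
from `ν` to every real `μ` in the resolvent set. -/

namespace BlockOp

/-! ### Real shifts of an operator and lower bounds. -/

section Shift

variable {E : Type*} [NormedAddCommGroup E] [InnerProductSpace ℂ E]

lemma mem_sub_scalarOp_domain {T : E →ₗ.[ℂ] E} {c : ℂ} {x : E} :
    x ∈ (T - scalarOp E c).domain ↔ x ∈ T.domain := by
  rw [LinearPMap.sub_domain]
  exact ⟨fun h => h.1, fun h => ⟨h, trivial⟩⟩

lemma sub_scalarOp_apply {T : E →ₗ.[ℂ] E} {c : ℂ} {x : E} (hx : x ∈ (T - scalarOp E c).domain) :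
    (T - scalarOp E c) ⟨x, hx⟩ = T ⟨x, hx.1⟩ - c • x := rfl

lemma bound_of_isBoundedBelow {T : E →ₗ.[ℂ] E} {δ : ℝ} (hδ : IsBoundedBelow T δ)
    (x : T.domain) : δ * ‖(x : E)‖ ≤ ‖T x‖ := by
  rcases (norm_nonneg (x : E)).eq_or_lt with h0 | h0
  · rw [← h0]; simp
  · have h1 := hδ x
    have h2 : (⟪T x, (x : E)⟫_ℂ).re ≤ ‖T x‖ * ‖(x : E)‖ := re_inner_le_norm (𝕜 := ℂ) _ _
    nlinarith

lemma isBoundedBelow_sub {T : E →ₗ.[ℂ] E} {η : ℝ} (h : IsBoundedBelow T η) (μ : ℝ) :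
    IsBoundedBelow (T - scalarOp E (μ : ℂ)) (η - μ) := by
  rintro ⟨x, hx⟩
  have h1 := h ⟨x, hx.1⟩
  rw [sub_scalarOp_apply, inner_sub_left, inner_smul_left, Complex.conj_ofReal, Complex.sub_re,
    Complex.re_ofReal_mul]
  have h2 : (⟪x, x⟫_ℂ).re = ‖x‖ ^ 2 := inner_self_eq_norm_sq (𝕜 := ℂ) x
  rw [h2]
  simp only at h1 ⊢
  linarith

end Shift

/-! ### Criteria for self-adjointness and for membership in the domain. -/

section Adjoint

variable {E F : Type*}
  [NormedAddCommGroup E] [InnerProductSpace ℂ E] [CompleteSpace E]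
  [NormedAddCommGroup F] [InnerProductSpace ℂ F]

lemma inner_adjoint {T : E →ₗ.[ℂ] F} (hT : Dense (T.domain : Set E)) {y : F} {x : E}
    (hy : y ∈ T.adjoint.domain) (hx : x ∈ T.domain) :
    ⟪T.adjoint ⟨y, hy⟩, x⟫_ℂ = ⟪y, T ⟨x, hx⟩⟫_ℂ :=
  LinearPMap.adjoint_isFormalAdjoint hT ⟨y, hy⟩ ⟨x, hx⟩

lemma inner_selfAdjoint {T : E →ₗ.[ℂ] E} (hT : IsSelfAdjoint T) {x y : E}
    (hx : x ∈ T.domain) (hy : y ∈ T.domain) :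
    ⟪T ⟨x, hx⟩, y⟫_ℂ = ⟪x, T ⟨y, hy⟩⟫_ℂ := by
  have h := LinearPMap.adjoint_isFormalAdjoint hT.dense_domain
  rw [LinearPMap.isSelfAdjoint_def.mp hT] at h
  exact h ⟨x, hx⟩ ⟨y, hy⟩

lemma mem_domain_of_selfAdjoint {T : E →ₗ.[ℂ] E} (hT : IsSelfAdjoint T) {y w : E}
    (h : ∀ x (hx : x ∈ T.domain), ⟪w, x⟫_ℂ = ⟪y, T ⟨x, hx⟩⟫_ℂ) :
    y ∈ T.domain := by
  have h' := LinearPMap.mem_adjoint_domain_of_exists (T := T) y ⟨w, fun x => h x x.2⟩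
  rwa [LinearPMap.isSelfAdjoint_def.mp hT] at h'

/-- A densely defined symmetric operator whose domain contains that of its adjoint is
self-adjoint. -/
lemma isSelfAdjoint_of_symmetric {T : E →ₗ.[ℂ] E} (hT : Dense (T.domain : Set E))
    (hsymm : T.IsFormalAdjoint T)
    (hmem : ∀ y w : E, (∀ x : T.domain, ⟪w, (x : E)⟫_ℂ = ⟪y, T x⟫_ℂ) → y ∈ T.domain) :
    IsSelfAdjoint T := by
  rw [LinearPMap.isSelfAdjoint_def]
  have hle := hsymm.le_adjoint hT
  refine (LinearPMap.eq_of_le_of_domain_eq hle (le_antisymm hle.1 fun y hy => ?_)).symm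
  exact hmem y (T.adjoint ⟨y, hy⟩) fun x => LinearPMap.adjoint_isFormalAdjoint hT ⟨y, hy⟩ x

lemma isSelfAdjoint_sub_scalarOp {T : E →ₗ.[ℂ] E} (hT : IsSelfAdjoint T) (c : ℝ) :
    IsSelfAdjoint (T - scalarOp E (c : ℂ)) := by
  refine isSelfAdjoint_of_symmetric ?_ ?_ ?_
  · refine hT.dense_domain.mono fun x hx => ?_
    exact mem_sub_scalarOp_domain.2 hx
  · rintro ⟨x, hx⟩ ⟨y, hy⟩
    rw [sub_scalarOp_apply, sub_scalarOp_apply, inner_sub_left, inner_sub_right,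
      inner_selfAdjoint hT hx.1 hy.1, inner_smul_left, inner_smul_right]
    simp
  · intro y w h
    refine mem_sub_scalarOp_domain.2 (mem_domain_of_selfAdjoint hT (w := w + (c : ℂ) • y) ?_)
    intro x hx
    have := h ⟨x, mem_sub_scalarOp_domain.2 hx⟩
    rw [sub_scalarOp_apply, inner_sub_right, inner_smul_right] at this
    rw [inner_add_left, this, inner_smul_left]
    simp

end Adjoint

/-! ### Bounded inverses and resolvents. -/

section Inverse

variable {E : Type*} [NormedAddCommGroup E] [InnerProductSpace ℂ E]

lemma IsBoundedInverse.mem {T : E →ₗ.[ℂ] E} {R : E →L[ℂ] E} (h : IsBoundedInverse T R) (y : E) :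
    R y ∈ T.domain := (h.2 y).1

lemma IsBoundedInverse.apply {T : E →ₗ.[ℂ] E} {R : E →L[ℂ] E} (h : IsBoundedInverse T R) (y : E)
    (hy : R y ∈ T.domain) : T ⟨R y, hy⟩ = y := (h.2 y).2

lemma IsBoundedInverse.mem_of_sub {T : E →ₗ.[ℂ] E} {c : ℂ} {R : E →L[ℂ] E}
    (h : IsBoundedInverse (T - scalarOp E c) R) (y : E) : R y ∈ T.domain := (h.mem y).1

lemma IsBoundedInverse.apply_of_sub {T : E →ₗ.[ℂ] E} {c : ℂ} {R : E →L[ℂ] E}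
    (h : IsBoundedInverse (T - scalarOp E c) R) (y : E) (hy : R y ∈ T.domain) :
    T ⟨R y, hy⟩ = y + c • R y := by
  have : T ⟨R y, hy⟩ - c • R y = y := h.apply y (h.mem y)
  rw [← sub_eq_iff_eq_add]; exact this

lemma IsBoundedInverse.apply_left_of_sub {T : E →ₗ.[ℂ] E} {c : ℂ} {R : E →L[ℂ] E}
    (h : IsBoundedInverse (T - scalarOp E c) R) (x : E) (hx : x ∈ T.domain) :
    R (T ⟨x, hx⟩ - c • x) = x := h.1 ⟨x, hx, trivial⟩

variable [CompleteSpace E]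

lemma IsBoundedInverse.symmetric {T : E →ₗ.[ℂ] E} (hT : IsSelfAdjoint T) {R : E →L[ℂ] E}
    (h : IsBoundedInverse T R) (x y : E) : ⟪R x, y⟫_ℂ = ⟪x, R y⟫_ℂ := by
  have := inner_selfAdjoint hT (h.mem x) (h.mem y)
  rw [h.apply, h.apply] at this
  exact this.symm

/-- A self-adjoint operator with a positive lower bound has a bounded inverse. -/
lemma exists_isBoundedInverse {T : E →ₗ.[ℂ] E} (hT : IsSelfAdjoint T) {δ : ℝ} (hδ0 : 0 < δ)
    (hδ : IsBoundedBelow T δ) : ∃ R : E →L[ℂ] E, IsBoundedInverse T R := by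
  have hb := bound_of_isBoundedBelow hδ
  have hinj : Function.Injective T.toFun := by
    refine (injective_iff_map_eq_zero _).2 fun x hx => ?_
    have h := hb x
    rw [LinearPMap.toFun_eq_coe] at hx
    rw [hx, norm_zero] at h
    have : ‖(x : E)‖ ≤ 0 := by nlinarith [norm_nonneg (x : E)]
    exact Subtype.ext (norm_le_zero_iff.1 this)
  have hclosed : IsClosed (LinearMap.range T.toFun : Set E) := by
    have : CompleteSpace T.graph := hT.isClosed.completeSpace_coe
    let f : T.graph →L[ℂ] E := (ContinuousLinearMap.snd ℂ E E).comp T.graph.subtypeL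
    -- The graph carries the sup norm, so the constant must dominate both `‖z‖ ≤ δ⁻¹ ‖T z‖` and `‖T
    -- z‖` itself. An antilipschitz map on the complete graph has closed range.
    have hf : AntilipschitzWith (Real.toNNReal (max δ⁻¹ 1)) f := by
      refine AddMonoidHomClass.antilipschitz_of_bound f fun p => ?_
      obtain ⟨⟨x, y⟩, hp⟩ := p
      obtain ⟨z, rfl, rfl⟩ := (LinearPMap.mem_graph_iff _).1 hp
      have h1 : (0 : ℝ) ≤ max δ⁻¹ 1 := by positivity
      rw [Real.coe_toNNReal _ h1]
      change max ‖(z : E)‖ ‖T z‖ ≤ max δ⁻¹ 1 * ‖T z‖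
      have h2 : ‖(z : E)‖ ≤ δ⁻¹ * ‖T z‖ := by
        rw [inv_mul_eq_div, le_div_iff₀ hδ0]; linarith [hb z]
      refine max_le (h2.trans ?_) ?_
      · gcongr; exact le_max_left _ _
      · nlinarith [le_max_right δ⁻¹ 1, norm_nonneg (T z)]
    have h := hf.isClosed_range f.uniformContinuous
    convert h using 1
    ext y
    simp only [SetLike.mem_coe, LinearMap.mem_range, Set.mem_range]
    constructor
    · rintro ⟨x, rfl⟩
      exact ⟨⟨(x, T x), T.mem_graph x⟩, rfl⟩
    · rintro ⟨⟨⟨x, y⟩, hp⟩, rfl⟩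
      obtain ⟨z, rfl, rfl⟩ := (LinearPMap.mem_graph_iff _).1 hp
      exact ⟨z, rfl⟩
  have hsurj : LinearMap.range T.toFun = ⊤ := by
    have : CompleteSpace (LinearMap.range T.toFun) := hclosed.completeSpace_coe
    -- A vector orthogonal to the range lies in the kernel of `T* = T`, which is trivial by the
    -- lower bound.
    rw [← Submodule.orthogonal_eq_bot_iff, Submodule.eq_bot_iff]
    intro y hy
    have hz : ∀ x (hx : x ∈ T.domain), ⟪y, T ⟨x, hx⟩⟫_ℂ = 0 := fun x hx =>
      (Submodule.mem_orthogonal' _ _).1 hy _ ⟨⟨x, hx⟩, rfl⟩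
    have hyd : y ∈ T.domain := mem_domain_of_selfAdjoint hT (w := 0) fun x hx => by
      rw [hz x hx, inner_zero_left]
    have hTy : T ⟨y, hyd⟩ = 0 :=
      hT.dense_domain.eq_zero_of_inner_left ℂ fun x hx => by
        rw [inner_selfAdjoint hT hyd hx, hz x hx]
    exact congrArg Subtype.val (hinj (a₁ := ⟨y, hyd⟩) (a₂ := 0) (by
      rw [LinearPMap.toFun_eq_coe, hTy, map_zero]))
  let e : T.domain ≃ₗ[ℂ] E := LinearEquiv.ofBijective T.toFun ⟨hinj, LinearMap.range_eq_top.1 hsurj⟩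
  have he : ∀ x, T (e.symm x) = x := fun x => e.apply_symm_apply x
  refine ⟨(T.domain.subtype.comp e.symm.toLinearMap).mkContinuous δ⁻¹ fun y => ?_, ?_, ?_⟩
  · have := hb (e.symm y)
    rw [he] at this
    rw [inv_mul_eq_div, le_div_iff₀ hδ0, mul_comm]
    exact this
  · intro x
    exact congrArg Subtype.val (e.symm_apply_apply x)
  · intro y
    exact ⟨(e.symm y).2, he y⟩

end Inverse

/-! ### Relative boundedness from the closed graph theorem. -/

section ClosedGraph

variable {E F G : Type*}
  [NormedAddCommGroup E] [InnerProductSpace ℂ E] [CompleteSpace E]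
  [NormedAddCommGroup F] [InnerProductSpace ℂ F] [CompleteSpace F]
  [NormedAddCommGroup G] [InnerProductSpace ℂ G] [CompleteSpace G]

/-- A closed operator is relatively bounded with respect to any closed operator with smaller
domain. -/
lemma isRelBounded_of_isClosed {g : E →ₗ.[ℂ] F} {f : E →ₗ.[ℂ] G} (hg : g.IsClosed)
    (hf : f.IsClosed) (h : f.domain ≤ g.domain) : IsRelBounded g f := by
  have : CompleteSpace f.graph := hf.completeSpace_coe
  have hm : ∀ p : f.graph, p.1.1 ∈ g.domain := fun p => h (LinearPMap.mem_domain_of_mem_graph p.2)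
  -- The closed graph theorem is applied to `g` read as an everywhere defined map on the Banach
  -- space `f.graph`.
  let L : f.graph →ₗ[ℂ] F := g.toFun.comp
    (((LinearMap.fst ℂ E G).comp f.graph.subtype).codRestrict g.domain hm)
  have hL : Continuous L := by
    refine L.continuous_of_isClosed_graph ?_
    have hc : Continuous fun q : f.graph × F => (q.1.1.1, q.2) := by fun_prop
    convert hg.preimage hc using 1
    ext ⟨p, y⟩
    simp only [SetLike.mem_coe, LinearMap.mem_graph_iff, Set.mem_preimage,
      LinearPMap.mem_graph_iff]
    constructor
    · rintro rfl
      exact ⟨⟨p.1.1, hm p⟩, rfl, rfl⟩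
    · rintro ⟨⟨x, hx⟩, h1, rfl⟩
      obtain rfl : x = p.1.1 := h1
      rfl
  let L' : f.graph →L[ℂ] F := ⟨L, hL⟩
  refine ⟨h, ‖L'‖, ‖L'‖, L'.opNorm_nonneg, L'.opNorm_nonneg, fun x => ?_⟩
  have h1 : ‖L' ⟨((x : E), f x), f.mem_graph x⟩‖ ≤ ‖L'‖ * max ‖(x : E)‖ ‖f x‖ := L'.le_opNorm _
  refine h1.trans ?_
  rw [← mul_add]
  gcongr
  exact max_le (by linarith [norm_nonneg (f x)]) (by linarith [norm_nonneg (x : E)])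

end ClosedGraph

/-! ### Closures and bounded perturbations. -/

section Closure

variable {E F : Type*}
  [NormedAddCommGroup E] [InnerProductSpace ℂ E]
  [NormedAddCommGroup F] [InnerProductSpace ℂ F]

lemma closure_eq_of_isClosed {f : E →ₗ.[ℂ] F} (hf : f.IsClosed) : f.closure = f := by
  refine LinearPMap.eq_of_eq_graph ?_
  rw [← hf.isClosable.graph_closure_eq_closure_graph]
  exact hf.submodule_topologicalClosure_eq

lemma mem_closure_graph_iff {f : E →ₗ.[ℂ] F} (hf : f.IsClosable) {p : E × F} :
    p ∈ f.closure.graph ↔ p ∈ closure (f.graph : Set (E × F)) := by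
  rw [← hf.graph_closure_eq_closure_graph]; rfl

lemma isClosable_of_forall {f : E →ₗ.[ℂ] F}
    (h : ∀ y : F, ((0 : E), y) ∈ closure (f.graph : Set (E × F)) → y = 0) : f.IsClosable := by
  refine ⟨f.graph.topologicalClosure.toLinearPMap, ?_⟩
  rw [Submodule.toLinearPMap_graph_eq]
  rintro ⟨x, y⟩ hx rfl
  exact h y hx

lemma mem_graph_toPMap_top {L : E →L[ℂ] F} {p : E × F} :
    p ∈ ((L : E →ₗ[ℂ] F).toPMap ⊤).graph ↔ p.2 = L p.1 := by
  rw [LinearPMap.mem_graph_iff]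
  constructor
  · rintro ⟨y, h1, h2⟩
    rw [← h2, ← h1]; rfl
  · intro h
    exact ⟨⟨p.1, trivial⟩, rfl, h.symm⟩

lemma isClosed_toPMap_top (L : E →L[ℂ] F) : ((L : E →ₗ[ℂ] F).toPMap ⊤).IsClosed := by
  have : (((L : E →ₗ[ℂ] F).toPMap ⊤).graph : Set (E × F)) = {p | p.2 = L p.1} := by
    ext p; exact mem_graph_toPMap_top
  rw [LinearPMap.IsClosed, this]
  exact isClosed_eq continuous_snd (by fun_prop)

/-- The closure of a densely defined bounded operator is its continuous extension. -/
lemma closure_of_dense_bounded {f : E →ₗ.[ℂ] F} (hf : Dense (f.domain : Set E)) {L : E →L[ℂ] F}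
    (h : ∀ x : f.domain, f x = L x) :
    f.IsClosable ∧ f.closure = (L : E →ₗ[ℂ] F).toPMap ⊤ := by
  have hle : f ≤ (L : E →ₗ[ℂ] F).toPMap ⊤ := by
    refine ⟨le_top, fun x y hxy => ?_⟩
    rw [h x, hxy]; rfl
  have hc := (isClosed_toPMap_top L).isClosable.leIsClosable hle
  refine ⟨hc, LinearPMap.eq_of_eq_graph (le_antisymm ?_ ?_)⟩
  · have := (isClosed_toPMap_top L).isClosable.closure_mono hle
    rw [closure_eq_of_isClosed (isClosed_toPMap_top L)] at this
    exact LinearPMap.le_graph_of_le this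
  · rintro ⟨x, y⟩ hp
    obtain rfl : y = L x := mem_graph_toPMap_top.1 hp
    rw [mem_closure_graph_iff hc]
    have hcont : Continuous fun x : E => (x, L x) := by fun_prop
    refine closure_mono ?_ (image_closure_subset_closure_image hcont ⟨x, hf x, rfl⟩)
    rintro _ ⟨z, hz, rfl⟩
    exact (LinearPMap.mem_graph_iff _).2 ⟨⟨z, hz⟩, rfl, h ⟨z, hz⟩⟩

/-- Adding `L` shears the graph. The shear is a homeomorphism of `E × F`, so it commutes with
closure; `closure_add_bounded` rests on this. -/
lemma mem_graph_add_toPMap_top {f : E →ₗ.[ℂ] F} {L : E →L[ℂ] F} {p : E × F} :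
    p ∈ (f + (L : E →ₗ[ℂ] F).toPMap ⊤).graph ↔ (p.1, p.2 - L p.1) ∈ f.graph := by
  rw [LinearPMap.mem_graph_iff, LinearPMap.mem_graph_iff]
  constructor
  · rintro ⟨⟨x, hx⟩, h1, h2⟩
    refine ⟨⟨x, hx.1⟩, h1, ?_⟩
    rw [eq_sub_iff_add_eq, ← h2, ← h1]; rfl
  · rintro ⟨⟨x, hx⟩, h1, h2⟩
    refine ⟨⟨x, hx, trivial⟩, h1, ?_⟩
    rw [eq_sub_iff_add_eq] at h2
    rw [← h2, ← h1]; rfl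

/-- Taking closures commutes with adding a bounded everywhere defined operator. -/
lemma closure_add_bounded {f : E →ₗ.[ℂ] F} (hf : f.IsClosable) (L : E →L[ℂ] F) :
    (f + (L : E →ₗ[ℂ] F).toPMap ⊤).IsClosable ∧
      (f + (L : E →ₗ[ℂ] F).toPMap ⊤).closure = f.closure + (L : E →ₗ[ℂ] F).toPMap ⊤ := by
  let Φ : E × F ≃ₜ E × F :=
    { toFun := fun p => (p.1, p.2 - L p.1)
      invFun := fun p => (p.1, p.2 + L p.1)
      left_inv := fun p => by simp
      right_inv := fun p => by simp
      continuous_toFun := by fun_prop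
      continuous_invFun := by fun_prop }
  have hpre : ((f + (L : E →ₗ[ℂ] F).toPMap ⊤).graph : Set (E × F)) = Φ ⁻¹' f.graph := by
    ext p; exact mem_graph_add_toPMap_top
  have key : (f + (L : E →ₗ[ℂ] F).toPMap ⊤).graph.topologicalClosure =
      (f.closure + (L : E →ₗ[ℂ] F).toPMap ⊤).graph := by
    ext p
    rw [mem_graph_add_toPMap_top, mem_closure_graph_iff hf, ← SetLike.mem_coe,
      Submodule.topologicalClosure_coe, hpre, ← Φ.preimage_closure]
    rfl
  have hc : (f + (L : E →ₗ[ℂ] F).toPMap ⊤).IsClosable := ⟨_, key⟩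
  exact ⟨hc, LinearPMap.eq_of_eq_graph (hc.graph_closure_eq_closure_graph.symm.trans key)⟩

end Closure

/-! ### Bounded compositions with a closed operator. -/

section ExtendBound

variable {E F K : Type*}
  [NormedAddCommGroup E] [InnerProductSpace ℂ E]
  [NormedAddCommGroup F] [InnerProductSpace ℂ F] [CompleteSpace F]
  [NormedAddCommGroup K] [InnerProductSpace ℂ K]

/-- If `Z` is closed and `Z G` is defined and bounded on a dense subspace, then `Z G` is defined
everywhere and bounded. -/
lemma exists_bounded_comp {Z : E →ₗ.[ℂ] F} (hZ : Z.IsClosed) (G : K →L[ℂ] E)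
    {p : Submodule ℂ K} (hp : Dense (p : Set K)) {C : ℝ}
    (h : ∀ v ∈ p, ∃ hv : G v ∈ Z.domain, ‖Z ⟨G v, hv⟩‖ ≤ C * ‖v‖) :
    ∃ W : K →L[ℂ] F, ∀ v, ‖W v‖ ≤ C * ‖v‖ ∧ ∃ hv : G v ∈ Z.domain, Z ⟨G v, hv⟩ = W v := by
  let f : p →ₗ[ℂ] F := Z.toFun.comp (((G : K →ₗ[ℂ] E).comp p.subtype).codRestrict Z.domain
    fun v => (h v v.2).choose)
  have hf : ∀ v : p, ‖f v‖ ≤ C * ‖p.subtype v‖ := fun v => (h v v.2).choose_spec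
  have hd : DenseRange p.subtype := hp.denseRange_val
  refine ⟨f.extendOfNorm p.subtype, fun v =>
    ⟨LinearMap.norm_extendOfNorm_apply_le hd C hf v, ?_⟩⟩
  suffices hg : (G v, f.extendOfNorm p.subtype v) ∈ Z.graph by
    obtain ⟨⟨x, hx⟩, h1, h2⟩ := (LinearPMap.mem_graph_iff _).1 hg
    obtain rfl : x = G v := h1
    exact ⟨hx, h2⟩
  have hc : IsClosed {v : K | (G v, f.extendOfNorm p.subtype v) ∈ Z.graph} :=
    hZ.preimage (f := fun v : K => (G v, f.extendOfNorm p.subtype v)) (by fun_prop)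
  refine hc.closure_subset_iff.2 ?_ (hp v)
  intro v hv
  refine (LinearPMap.mem_graph_iff _).2 ⟨⟨G v, (h v hv).choose⟩, rfl, ?_⟩
  exact (LinearMap.extendOfNorm_eq hd ⟨C, hf⟩ ⟨v, hv⟩).symm

end ExtendBound

/-! ### Heinz inequality and the form bound. -/

section FormBound

variable {E F : Type*}
  [NormedAddCommGroup E] [InnerProductSpace ℂ E] [CompleteSpace E]
  [NormedAddCommGroup F] [InnerProductSpace ℂ F] [CompleteSpace F]

/-- The hypothesis says `q² ≤ (k a)²`, and the square root is operator monotone on positive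
operators. -/
lemma re_inner_le_of_norm_le {q a : E →L[ℂ] E} (hq : q.IsPositive) (ha : a.IsPositive) {k : ℝ}
    (hk : 0 ≤ k) (h : ∀ y, ‖q y‖ ≤ k * ‖a y‖) (y : E) :
    (⟪q y, y⟫_ℂ).re ≤ k * (⟪a y, y⟫_ℂ).re := by
  have hka : ((k : ℂ) • a).IsPositive := ha.smul_of_nonneg (by simpa using hk)
  have hsq : q * q ≤ ((k : ℂ) • a) * ((k : ℂ) • a) := by
    rw [ContinuousLinearMap.le_def, ContinuousLinearMap.isPositive_def']
    refine ⟨?_, fun x => ?_⟩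
    · have h1 := hq.isSelfAdjoint
      have h2 := hka.isSelfAdjoint
      rw [IsSelfAdjoint, star_sub, star_mul, star_mul, h1.star_eq, h2.star_eq]
    · rw [ContinuousLinearMap.reApplyInnerSelf_apply, sub_apply,
        inner_sub_left, mul_apply_eq_comp, mul_apply_eq_comp,
        hq.inner_left_eq_inner_right, hka.inner_left_eq_inner_right, map_sub,
        inner_self_eq_norm_sq, inner_self_eq_norm_sq, sub_nonneg]
      have h1 : ‖((k : ℂ) • a) x‖ = k * ‖a x‖ := by
        rw [smul_apply, norm_smul, Complex.norm_real, Real.norm_of_nonneg hk]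
      rw [h1]
      exact pow_le_pow_left₀ (norm_nonneg _) (h x) 2
  have hle := CFC.sqrt_le_sqrt _ _ hsq
  rw [CFC.sqrt_mul_self q ((ContinuousLinearMap.nonneg_iff_isPositive q).2 hq),
    CFC.sqrt_mul_self _ ((ContinuousLinearMap.nonneg_iff_isPositive _).2 hka),
    ContinuousLinearMap.le_def] at hle
  have h1 := hle.re_inner_nonneg_left y
  rw [sub_apply, inner_sub_left, smul_apply,
    inner_smul_left, map_sub, Complex.conj_ofReal] at h1
  simpa using h1

lemma IsBoundedInverse.isPositive {T : E →ₗ.[ℂ] E} (hT : IsSelfAdjoint T) {δ : ℝ} (hδ0 : 0 ≤ δ)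
    (hδ : IsBoundedBelow T δ) {R : E →L[ℂ] E} (h : IsBoundedInverse T R) : R.IsPositive := by
  refine ⟨fun x y => h.symmetric hT x y, fun x => ?_⟩
  have h1 := hδ ⟨R x, h.mem x⟩
  rw [h.apply] at h1
  rw [ContinuousLinearMap.reApplyInnerSelf_apply, ← inner_conj_symm, RCLike.conj_re]
  exact le_trans (by positivity) h1

/-- Heinz inequality: for self-adjoint operators, an operator bound implies a form bound. -/
lemma re_inner_le_of_norm_apply_le {P Q : E →ₗ.[ℂ] E} (hP : IsSelfAdjoint P)
    (hQ : IsSelfAdjoint Q) (hP1 : IsBoundedBelow P 1) (hQ1 : IsBoundedBelow Q 1)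
    (hdom : Q.domain ≤ P.domain) {k : ℝ} (hk : 0 < k)
    (h : ∀ x (hx : x ∈ Q.domain), ‖P ⟨x, hdom hx⟩‖ ≤ k * ‖Q ⟨x, hx⟩‖)
    {x : E} (hx : x ∈ Q.domain) :
    (⟪P ⟨x, hdom hx⟩, x⟫_ℂ).re ≤ k * (⟪Q ⟨x, hx⟩, x⟫_ℂ).re := by
  obtain ⟨p, hp⟩ := exists_isBoundedInverse hP one_pos hP1
  obtain ⟨q, hq⟩ := exists_isBoundedInverse hQ one_pos hQ1
  have hpp := hp.isPositive hP zero_le_one hP1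
  have hqp := hq.isPositive hQ zero_le_one hQ1
  have hle : ∀ y, ‖q y‖ ≤ k * ‖p y‖ := by
    intro y
    -- Inserting `P p = 1` moves `P` onto `q (q y)`, where the hypothesis gives `‖P q (q y)‖ ≤ k ‖Q
    -- q (q y)‖ = k ‖q y‖`. One factor `‖q y‖` then cancels.
    have h1 : ⟪q y, q y⟫_ℂ = ⟪p y, P ⟨q (q y), hdom (hq.mem _)⟩⟫_ℂ := by
      rw [← inner_selfAdjoint hP (hp.mem y) (hdom (hq.mem _)), hp.apply,
        hqp.inner_left_eq_inner_right]
    have h2 : ‖q y‖ ^ 2 ≤ ‖p y‖ * (k * ‖q y‖) := by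
      rw [← inner_self_eq_norm_sq (𝕜 := ℂ), h1]
      refine (re_inner_le_norm _ _).trans ?_
      gcongr
      refine (h _ (hq.mem _)).trans ?_
      rw [hq.apply]
    rcases (norm_nonneg (q y)).eq_or_lt with h0 | h0
    · rw [← h0]; positivity
    · nlinarith
  have hform := re_inner_le_of_norm_le hqp hpp hk.le hle (P ⟨x, hdom hx⟩)
  have hpx : p (P ⟨x, hdom hx⟩) = x := hp.1 ⟨x, hdom hx⟩
  have hqx : q (Q ⟨x, hx⟩) = x := hq.1 ⟨x, hx⟩
  -- This inverts the inequality `q ≤ k p` between forms. With `f`, `g`, `r` as below, positivity of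
  -- `q` at `Q x - k⁻¹ P x` reads `g - 2 k⁻¹ f + k⁻² r ≥ 0`, and `r ≤ k f` leaves `k⁻¹ f ≤ g`.
  have hpos := hqp.re_inner_nonneg_left (Q ⟨x, hx⟩ - ((k⁻¹ : ℝ) : ℂ) • P ⟨x, hdom hx⟩)
  have hcross : ⟪q (P ⟨x, hdom hx⟩), Q ⟨x, hx⟩⟫_ℂ = ⟪P ⟨x, hdom hx⟩, x⟫_ℂ := by
    rw [hqp.inner_left_eq_inner_right, hqx]
  have hsymm : (⟪x, P ⟨x, hdom hx⟩⟫_ℂ).re = (⟪P ⟨x, hdom hx⟩, x⟫_ℂ).re := by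
    rw [inner_selfAdjoint hP]
  have hsymm' : (⟪x, Q ⟨x, hx⟩⟫_ℂ).re = (⟪Q ⟨x, hx⟩, x⟫_ℂ).re := by
    rw [inner_selfAdjoint hQ]
  rw [hpx, hsymm] at hform
  rw [map_sub, map_smul, hqx, inner_sub_left, inner_sub_right, inner_sub_right, inner_smul_left,
    inner_smul_right, inner_smul_left, inner_smul_right, hcross, Complex.conj_ofReal] at hpos
  simp only [map_sub, RCLike.re_to_complex, Complex.re_ofReal_mul, hsymm, hsymm'] at hpos
  set f := (⟪P ⟨x, hdom hx⟩, x⟫_ℂ).re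
  set g := (⟪Q ⟨x, hx⟩, x⟫_ℂ).re
  set r := (⟪q (P ⟨x, hdom hx⟩), P ⟨x, hdom hx⟩⟫_ℂ).re
  have h3 : k⁻¹ * (k⁻¹ * r) ≤ k⁻¹ * f := by
    have : k⁻¹ * r ≤ f := by rw [inv_mul_le_iff₀ hk]; exact hform
    gcongr
  have h4 : k⁻¹ * f ≤ g := by linarith
  rwa [inv_mul_le_iff₀ hk] at h4

/-- One factor `S` moves across the inner product. This serves twice: to compare `‖|T| x‖` with `‖T
x‖`, and to express `‖|T|^(1/2) x‖²` as the form of `|T|`. -/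
lemma norm_sq_of_natComp_self {S N : E →ₗ.[ℂ] E} (hS : IsSelfAdjoint S) (h : natComp S S = N)
    {x : E} (hx : x ∈ N.domain) :
    ∃ hx' : x ∈ S.domain, ‖S ⟨x, hx'⟩‖ ^ 2 = (⟪N ⟨x, hx⟩, x⟫_ℂ).re := by
  subst h
  obtain ⟨h1, h2⟩ := hx
  refine ⟨h1, ?_⟩
  have h3 : natComp S S ⟨x, h1, h2⟩ = S ⟨S ⟨x, h1⟩, h2⟩ := rfl
  rw [h3, inner_selfAdjoint hS h2 h1]
  exact (inner_self_eq_norm_sq (𝕜 := ℂ) _).symm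

lemma posSqrt_cases (A : E →ₗ.[ℂ] E) :
    (posSqrt A = 0) ∨ IsPosSqrt A (posSqrt A) := by
  classical
  by_cases h : ∃ S, IsPosSqrt A S
  · right; rw [posSqrt, dif_pos h]; exact h.choose_spec
  · left; rw [posSqrt, dif_neg h]

/-- Needed when `absOp` takes its default value `0`, whose square root is taken next. -/
lemma domain_posSqrt_zero : (posSqrt (0 : E →ₗ.[ℂ] E)).domain = ⊤ := by
  rcases posSqrt_cases (0 : E →ₗ.[ℂ] E) with h | ⟨-, -, h⟩
  · rw [h]; rfl
  · refine eq_top_iff.2 fun x _ => ?_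
    have hx : x ∈ (0 : E →ₗ.[ℂ] E).domain := trivial
    rw [← h] at hx
    exact hx.1

/-- Either `|T| ^ (1/2)` has the defining property of an iterated square root, or it is everywhere
defined by convention; this dichotomy makes the existence of square roots unnecessary below. -/
lemma sqrtAbsOp_cases (T : E →ₗ.[ℂ] E) : (sqrtAbsOp T).domain = ⊤ ∨
    (IsPosSqrt (natComp T.adjoint T) (absOp T) ∧ IsPosSqrt (absOp T) (sqrtAbsOp T)) := by
  rcases posSqrt_cases (natComp T.adjoint T) with h | h
  · left; rw [sqrtAbsOp, absOp, h, domain_posSqrt_zero]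
  · rcases posSqrt_cases (absOp T) with h' | h'
    · left; rw [sqrtAbsOp, h']; rfl
    · exact Or.inr ⟨h, h'⟩

/-- A self-adjoint `A` with `A ^ 2 = T ^ 2` is bounded relative to `T - μ`. -/
lemma exists_bound_of_natComp_eq {T A : E →ₗ.[ℂ] E} (hT : IsSelfAdjoint T) (hA : IsSelfAdjoint A)
    (h : natComp A A = natComp T T) {μ : ℝ} {q : E →L[ℂ] E}
    (hq : IsBoundedInverse (T - scalarOp E (μ : ℂ)) q) :
    ∃ c : ℝ, 0 ≤ c ∧ ∀ x (hx : x ∈ (T - scalarOp E (μ : ℂ)).domain), ∃ hx' : x ∈ A.domain,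
      ‖A ⟨x, hx'⟩‖ ≤ c * ‖(T - scalarOp E (μ : ℂ)) ⟨x, hx⟩‖ := by
  -- For `z ∈ dom T` the vector `q z` lies in `dom T²`, where `‖A q z‖ = ‖T q z‖ = ‖z + μ q z‖`.
  -- Density of `dom T` and closedness of `A` extend the bound to all `z`.
  obtain ⟨W, hW⟩ := exists_bounded_comp (C := 1 + |μ| * ‖q‖) hA.isClosed q hT.dense_domain (by
    intro z hz
    have hqz := hq.mem_of_sub z
    have hN : q z ∈ (natComp T T).domain := by
      refine ⟨hqz, ?_⟩
      rw [hq.apply_of_sub z hqz]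
      exact T.domain.add_mem hz (T.domain.smul_mem _ hqz)
    obtain ⟨h1, h2⟩ := norm_sq_of_natComp_self hA h hN
    obtain ⟨h3, h4⟩ := norm_sq_of_natComp_self hT rfl hN
    refine ⟨h1, ?_⟩
    have h5 : ‖A ⟨q z, h1⟩‖ = ‖T ⟨q z, h3⟩‖ :=
      (sq_eq_sq₀ (norm_nonneg _) (norm_nonneg _)).1 (h2.trans h4.symm)
    rw [h5, hq.apply_of_sub]
    calc ‖z + (μ : ℂ) • q z‖ ≤ ‖z‖ + ‖(μ : ℂ) • q z‖ := norm_add_le _ _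
      _ ≤ ‖z‖ + |μ| * (‖q‖ * ‖z‖) := by
        rw [norm_smul, Complex.norm_real, Real.norm_eq_abs]
        gcongr
        exact q.le_opNorm z
      _ = _ := by ring)
  refine ⟨1 + |μ| * ‖q‖, by positivity, fun x hx => ?_⟩
  have hqx : q ((T - scalarOp E (μ : ℂ)) ⟨x, hx⟩) = x := hq.1 ⟨x, hx⟩
  obtain ⟨h1, h2, h3⟩ := hW ((T - scalarOp E (μ : ℂ)) ⟨x, hx⟩)
  have h4 : ∀ y, y = x → ∀ hy : y ∈ A.domain, ∃ hx' : x ∈ A.domain, A ⟨x, hx'⟩ = A ⟨y, hy⟩ := by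
    rintro y rfl hy; exact ⟨hy, rfl⟩
  obtain ⟨h5, h6⟩ := h4 _ hqx h2
  exact ⟨h5, by rw [h6, h3]; exact h1⟩

/-- A closed operator defined on the domain of `|T| ^ (1/2)` is form bounded with respect to `T`. -/
lemma exists_form_bound {T : E →ₗ.[ℂ] E} {η : ℝ} (hT : IsSelfAdjoint T) (hη : IsBoundedBelow T η)
    {Z : E →ₗ.[ℂ] F} (hZ : Z.IsClosed) (hdom : (sqrtAbsOp T).domain ≤ Z.domain) :
    ∃ C : ℝ, 0 ≤ C ∧ ∀ u (hu : u ∈ T.domain), ∃ hu' : u ∈ Z.domain,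
      ‖Z ⟨u, hu'⟩‖ ^ 2 ≤ C * ((⟪T ⟨u, hu⟩, u⟫_ℂ).re - (η - 1) * ‖u‖ ^ 2) := by
  have hQ := isSelfAdjoint_sub_scalarOp hT (η - 1)
  have hQ1 : IsBoundedBelow (T - scalarOp E ((η - 1 : ℝ) : ℂ)) 1 := by
    have := isBoundedBelow_sub hη (η - 1)
    rwa [sub_sub_cancel] at this
  have hform : ∀ u (hu : u ∈ T.domain), ‖u‖ ^ 2 ≤ (⟪T ⟨u, hu⟩, u⟫_ℂ).re - (η - 1) * ‖u‖ ^ 2 := by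
    intro u hu
    have := hη ⟨u, hu⟩
    simp only at this
    linarith
  rcases sqrtAbsOp_cases T with htop | ⟨⟨hA, hA0, hAT⟩, hS, -, hSA⟩
  -- Here `Z` is everywhere defined. Comparison with the zero operator makes it bounded, and the
  -- form of `T - (η - 1)` dominates `‖u‖²`.
  · rw [htop, top_le_iff] at hdom
    obtain ⟨h, a, b, ha, -, hab⟩ := isRelBounded_of_isClosed hZ
      (isClosed_toPMap_top (0 : E →L[ℂ] E)) (by rw [hdom]; exact le_top)
    refine ⟨a ^ 2, by positivity, fun u hu => ⟨h trivial, ?_⟩⟩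
    have h1 : ‖Z ⟨u, h trivial⟩‖ ≤ a * ‖u‖ + b * ‖(0 : E)‖ := hab ⟨u, trivial⟩
    rw [norm_zero, mul_zero, add_zero] at h1
    calc _ ≤ (a * ‖u‖) ^ 2 := pow_le_pow_left₀ (norm_nonneg _) h1 2
      _ = a ^ 2 * ‖u‖ ^ 2 := by ring
      _ ≤ _ := by gcongr; exact hform u hu
  · rw [LinearPMap.isSelfAdjoint_def.mp hT] at hAT
    generalize absOp T = A at *
    generalize sqrtAbsOp T = S at *
    obtain ⟨q, hq⟩ := exists_isBoundedInverse hQ one_pos hQ1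
    obtain ⟨c, hc, hcA⟩ := exists_bound_of_natComp_eq hT hA hAT hq
    obtain ⟨h, a, b, ha, hb, hab⟩ := isRelBounded_of_isClosed hZ hS.isClosed hdom
    have hP := isSelfAdjoint_sub_scalarOp hA (-1)
    have hP1 : IsBoundedBelow (A - scalarOp E ((-1 : ℝ) : ℂ)) 1 := by
      have := isBoundedBelow_sub hA0 (-1)
      rwa [zero_sub, neg_neg] at this
    have hdom' : (T - scalarOp E ((η - 1 : ℝ) : ℂ)).domain ≤
        (A - scalarOp E ((-1 : ℝ) : ℂ)).domain := fun x hx =>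
      mem_sub_scalarOp_domain.2 (hcA x hx).choose
    have hform' : ∀ u (hu : u ∈ T.domain), ∃ hu' : u ∈ A.domain,
        (⟪A ⟨u, hu'⟩, u⟫_ℂ).re + ‖u‖ ^ 2 ≤
          (c + 1) * ((⟪T ⟨u, hu⟩, u⟫_ℂ).re - (η - 1) * ‖u‖ ^ 2) := by
      intro u hu
      have hu1 : u ∈ (T - scalarOp E ((η - 1 : ℝ) : ℂ)).domain := mem_sub_scalarOp_domain.2 hu
      -- Heinz is applied to `P = A + 1` and `Q = T - (η - 1)`, both at least `1`. The constant
      -- comes from `‖(A + 1) x‖ ≤ c ‖Q x‖ + ‖x‖` and `‖x‖ ≤ ‖Q x‖`.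
      have h1 := re_inner_le_of_norm_apply_le hP hQ hP1 hQ1 hdom' (k := c + 1) (by positivity)
        (fun x hx => by
          obtain ⟨h1, h2⟩ := hcA x hx
          have h3 := bound_of_isBoundedBelow hQ1 ⟨x, hx⟩
          rw [sub_scalarOp_apply]
          refine (norm_sub_le _ _).trans ?_
          rw [norm_smul, Complex.norm_real, norm_neg, norm_one, one_mul]
          simp only [one_mul] at h3
          linarith) hu1
      have h2 : (⟪u, u⟫_ℂ).re = ‖u‖ ^ 2 := inner_self_eq_norm_sq (𝕜 := ℂ) u
      rw [sub_scalarOp_apply, sub_scalarOp_apply, inner_sub_left, inner_sub_left, inner_smul_left,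
        inner_smul_left, Complex.conj_ofReal, Complex.conj_ofReal, Complex.sub_re,
        Complex.re_ofReal_mul, Complex.sub_re, Complex.re_ofReal_mul, h2] at h1
      exact ⟨(hcA u hu1).choose, by linarith⟩
    refine ⟨2 * (a ^ 2 + b ^ 2) * (c + 1), by positivity, fun u hu => ?_⟩
    obtain ⟨h1, h2⟩ := hform' u hu
    obtain ⟨h3, h4⟩ := norm_sq_of_natComp_self hS hSA h1
    refine ⟨h h3, ?_⟩
    have h5 : ‖Z ⟨u, h h3⟩‖ ≤ a * ‖u‖ + b * ‖S ⟨u, h3⟩‖ := hab ⟨u, h3⟩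
    rw [← h4] at h2
    set X := (⟪T ⟨u, hu⟩, u⟫_ℂ).re - (η - 1) * ‖u‖ ^ 2
    calc ‖Z ⟨u, h h3⟩‖ ^ 2 ≤ (a * ‖u‖ + b * ‖S ⟨u, h3⟩‖) ^ 2 :=
          pow_le_pow_left₀ (norm_nonneg _) h5 2
      _ ≤ 2 * (a ^ 2 + b ^ 2) * (‖S ⟨u, h3⟩‖ ^ 2 + ‖u‖ ^ 2) := by
        nlinarith [sq_nonneg (a * ‖u‖ - b * ‖S ⟨u, h3⟩‖), sq_nonneg (a * ‖S ⟨u, h3⟩‖),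
          sq_nonneg (b * ‖u‖)]
      _ ≤ 2 * (a ^ 2 + b ^ 2) * ((c + 1) * X) := by gcongr
      _ = _ := by ring

end FormBound

lemma continuous_toLp_pair {X H K : Type*} [TopologicalSpace X] [NormedAddCommGroup H]
    [NormedAddCommGroup K] {f : X → H} {g : X → K}
    (hf : Continuous f) (hg : Continuous g) :
    Continuous fun x => (WithLp.toLp 2 (f x, g x) : WithLp 2 (H × K)) :=
  (WithLp.prod_continuous_toLp 2 H K).comp (hf.prodMk hg)

/-! ### The Frobenius–Schur operator and its self-adjointness. -/

section Schur

variable {H K : Type*}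
  [NormedAddCommGroup H] [InnerProductSpace ℂ H] [CompleteSpace H]
  [NormedAddCommGroup K] [InnerProductSpace ℂ K] [CompleteSpace K]

/-- The linear map underlying `schurOp`. -/
noncomputable def schurMap (T : H →ₗ.[ℂ] H) (D : K →ₗ.[ℂ] K) (G : K →L[ℂ] H) (W : K →L[ℂ] K)
    (μ : ℂ) : ↥(D.domain.comap (WithLp.sndL 2 ℂ H K).toLinearMap ⊓
      T.domain.comap (WithLp.fstL 2 ℂ H K + G ∘L WithLp.sndL 2 ℂ H K).toLinearMap) →ₗ[ℂ]
        WithLp 2 (H × K) :=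
  let p := D.domain.comap (WithLp.sndL 2 ℂ H K).toLinearMap ⊓
    T.domain.comap (WithLp.fstL 2 ℂ H K + G ∘L WithLp.sndL 2 ℂ H K).toLinearMap
  let v : p →ₗ[ℂ] K := (WithLp.sndL 2 ℂ H K).toLinearMap.comp p.subtype
  let w : p →ₗ[ℂ] H := (WithLp.fstL 2 ℂ H K + G ∘L WithLp.sndL 2 ℂ H K).toLinearMap.comp p.subtype
  let Tw : p →ₗ[ℂ] H := T.toFun.comp (w.codRestrict T.domain fun x => x.2.2)
  let Dv : p →ₗ[ℂ] K := D.toFun.comp (v.codRestrict D.domain fun x => x.2.1)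
  (WithLp.linearEquiv 2 ℂ (H × K)).symm.toLinearMap.comp
    (LinearMap.prod (Tw - μ • G.toLinearMap.comp v)
      (G.adjoint.toLinearMap.comp (Tw - μ • w) - W.toLinearMap.comp v + Dv))

/-- The operator `(u, v) ↦ (T w - μ G v, G* (T w - μ w) - W v + D v)`, `w = u + G v`, on the
domain of all `(u, v)` with `w ∈ dom T` and `v ∈ dom D`; it is a Frobenius–Schur factorization
`[[1, 0], [G*, 1]] diag(T - μ, D - W) [[1, G], [0, 1]] + diag(μ, 0)`. -/
noncomputable def schurOp (T : H →ₗ.[ℂ] H) (D : K →ₗ.[ℂ] K) (G : K →L[ℂ] H) (W : K →L[ℂ] K)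
    (μ : ℂ) : WithLp 2 (H × K) →ₗ.[ℂ] WithLp 2 (H × K) where
  domain := D.domain.comap (WithLp.sndL 2 ℂ H K).toLinearMap ⊓
    T.domain.comap (WithLp.fstL 2 ℂ H K + G ∘L WithLp.sndL 2 ℂ H K).toLinearMap
  toFun := schurMap T D G W μ

variable {T : H →ₗ.[ℂ] H} {D : K →ₗ.[ℂ] K} {G : K →L[ℂ] H} {W : K →L[ℂ] K}

lemma mem_schurOp_domain {μ : ℂ} {x : WithLp 2 (H × K)} :
    x ∈ (schurOp T D G W μ).domain ↔ x.snd ∈ D.domain ∧ x.fst + G x.snd ∈ T.domain := Iff.rfl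

lemma mem_schurOp_domain_sub {μ : ℂ} {w : H} {v : K} :
    WithLp.toLp 2 (w - G v, v) ∈ (schurOp T D G W μ).domain ↔ v ∈ D.domain ∧ w ∈ T.domain := by
  rw [mem_schurOp_domain]
  change v ∈ D.domain ∧ w - G v + G v ∈ T.domain ↔ _
  rw [sub_add_cancel]

lemma schurOp_apply {μ : ℂ} {u : H} {v : K}
    (h : WithLp.toLp 2 (u, v) ∈ (schurOp T D G W μ).domain) :
    schurOp T D G W μ ⟨WithLp.toLp 2 (u, v), h⟩ = WithLp.toLp 2
      (T ⟨u + G v, h.2⟩ - μ • G v,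
        G.adjoint (T ⟨u + G v, h.2⟩ - μ • (u + G v)) - W v + D ⟨v, h.1⟩) := rfl

lemma schurOp_apply_sub {μ : ℂ} {w : H} {v : K}
    (h : WithLp.toLp 2 (w - G v, v) ∈ (schurOp T D G W μ).domain) (hw : w ∈ T.domain)
    (hv : v ∈ D.domain) :
    schurOp T D G W μ ⟨WithLp.toLp 2 (w - G v, v), h⟩ = WithLp.toLp 2
      (T ⟨w, hw⟩ - μ • G v, G.adjoint (T ⟨w, hw⟩ - μ • w) - W v + D ⟨v, hv⟩) := by
  rw [schurOp_apply]
  simp only [sub_add_cancel]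

lemma isSelfAdjoint_schurOp (hT : IsSelfAdjoint T) (hD : IsSelfAdjoint D)
    (hW : ∀ x y, ⟪W x, y⟫_ℂ = ⟪x, W y⟫_ℂ) (μ : ℝ) : IsSelfAdjoint (schurOp T D G W (μ : ℂ)) := by
  -- In the coordinates `w = u + G v` and `v` the domain becomes the product `dom T × dom D`.
  have heta : ∀ x : WithLp 2 (H × K),
      x = WithLp.toLp 2 ((x.fst + G x.snd) - G x.snd, x.snd) := fun x => by
    rw [add_sub_cancel_right]; rfl
  refine isSelfAdjoint_of_symmetric ?_ ?_ ?_
  · intro x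
    have hc : Continuous fun p : H × K => (WithLp.toLp 2 (p.1 - G p.2, p.2) : WithLp 2 (H × K)) :=
      continuous_toLp_pair (by fun_prop) (by fun_prop)
    rw [heta x]
    refine closure_mono ?_ (image_closure_subset_closure_image hc
      ⟨(x.fst + G x.snd, x.snd), (hT.dense_domain.prod hD.dense_domain) _, rfl⟩)
    rintro _ ⟨⟨w, v⟩, ⟨hw, hv⟩, rfl⟩
    exact mem_schurOp_domain_sub.2 ⟨hv, hw⟩
  · have key : ∀ (w w' : H) (v v' : K) (h : WithLp.toLp 2 (w - G v, v) ∈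
          (schurOp T D G W (μ : ℂ)).domain) (h' : WithLp.toLp 2 (w' - G v', v') ∈
          (schurOp T D G W (μ : ℂ)).domain),
        ⟪schurOp T D G W (μ : ℂ) ⟨_, h⟩, WithLp.toLp 2 (w' - G v', v')⟫_ℂ =
          ⟪WithLp.toLp 2 (w - G v, v), schurOp T D G W (μ : ℂ) ⟨_, h'⟩⟫_ℂ := by
      intro w w' v v' h h'
      obtain ⟨hv, hw⟩ := mem_schurOp_domain_sub.1 h
      obtain ⟨hv', hw'⟩ := mem_schurOp_domain_sub.1 h'
      rw [schurOp_apply_sub h hw hv, schurOp_apply_sub h' hw' hv', WithLp.prod_inner_apply,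
        WithLp.prod_inner_apply]
      simp only [inner_sub_left, inner_sub_right, inner_add_left, inner_add_right,
        ContinuousLinearMap.adjoint_inner_left, ContinuousLinearMap.adjoint_inner_right,
        inner_smul_left, inner_smul_right, Complex.conj_ofReal, inner_selfAdjoint hT hw hw',
        inner_selfAdjoint hD hv hv', hW, map_sub, map_smul]
      rw [← inner_selfAdjoint hT hw hw']
      ring
    intro x y
    obtain ⟨x, hx⟩ := x
    obtain ⟨y, hy⟩ := y
    have h1 := key (x.fst + G x.snd) (y.fst + G y.snd) x.snd y.snd (heta x ▸ hx) (heta y ▸ hy)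
    simpa only [← heta] using h1
  · intro y p h
    have h' : ∀ (w : H) (v : K) (hw : w ∈ T.domain) (hv : v ∈ D.domain),
        ⟪p.fst, w - G v⟫_ℂ + ⟪p.snd, v⟫_ℂ = ⟪y.fst, T ⟨w, hw⟩ - (μ : ℂ) • G v⟫_ℂ +
          ⟪y.snd, G.adjoint (T ⟨w, hw⟩ - (μ : ℂ) • w) - W v + D ⟨v, hv⟩⟫_ℂ := by
      intro w v hw hv
      have := h ⟨_, mem_schurOp_domain_sub.2 ⟨hv, hw⟩⟩
      rw [schurOp_apply_sub _ hw hv, WithLp.prod_inner_apply, WithLp.prod_inner_apply] at this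
      exact this
    -- Testing with `w = 0` isolates `D` and gives `y.snd ∈ dom D`; testing with `v = 0` isolates
    -- `T` and gives `y.fst + G y.snd ∈ dom T`.
    refine mem_schurOp_domain.2 ⟨?_, ?_⟩
    · refine mem_domain_of_selfAdjoint hD
        (w := p.snd - G.adjoint p.fst + (μ : ℂ) • G.adjoint y.fst + W y.snd) fun v hv => ?_
      have h1 := h' 0 v T.domain.zero_mem hv
      have h2 : T ⟨0, T.domain.zero_mem⟩ = 0 := T.map_zero
      rw [h2] at h1
      simp only [zero_sub, smul_zero, sub_zero, map_zero, inner_neg_right, inner_add_right,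
        inner_smul_right] at h1
      simp only [inner_sub_left, inner_add_left, inner_smul_left, Complex.conj_ofReal, hW,
        ContinuousLinearMap.adjoint_inner_left]
      linear_combination h1
    · refine mem_domain_of_selfAdjoint hT
        (w := p.fst + (μ : ℂ) • G y.snd) fun w hw => ?_
      have h1 := h' w 0 hw D.domain.zero_mem
      have h2 : D ⟨0, D.domain.zero_mem⟩ = 0 := D.map_zero
      rw [h2] at h1
      simp only [map_zero, sub_zero, smul_zero, inner_zero_right, add_zero, map_sub, map_smul,
        inner_sub_right, inner_smul_right, ContinuousLinearMap.adjoint_inner_right] at h1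
      simp only [inner_add_left, inner_smul_left, Complex.conj_ofReal]
      linear_combination h1

end Schur

/-! ### Dependence on the spectral parameter. -/

section ResolventIdentity

variable {H K : Type*}
  [NormedAddCommGroup H] [InnerProductSpace ℂ H]
  [NormedAddCommGroup K] [InnerProductSpace ℂ K]
  {T : H →ₗ.[ℂ] H} {B : K →ₗ.[ℂ] H}

/-- First resolvent identity for the closures of `(T - μ)⁻¹ B`. -/
lemma resolvent_comp_sub (hB : Dense (B.domain : Set K)) {μ ν : ℂ} {R S : H →L[ℂ] H}
    (hR : IsBoundedInverse (T - scalarOp H μ) R) (hS : IsBoundedInverse (T - scalarOp H ν) S)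
    {G J : K →L[ℂ] H} (hG : ∀ v (hv : v ∈ B.domain), G v = R (B ⟨v, hv⟩))
    (hJ : ∀ v (hv : v ∈ B.domain), J v = S (B ⟨v, hv⟩)) (v : K) :
    G v = J v + (μ - ν) • R (J v) := by
  have hc : IsClosed {v : K | G v = J v + (μ - ν) • R (J v)} :=
    isClosed_eq (by fun_prop) (by fun_prop)
  refine hc.closure_subset_iff.2 ?_ (hB v)
  intro v hv
  rw [Set.mem_ofPred_eq, hG v hv, hJ v hv]
  set y := B ⟨v, hv⟩
  have h := hR.apply_left_of_sub (S y) (hS.mem_of_sub y)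
  rw [hS.apply_of_sub, add_sub_assoc, ← sub_smul, map_add, map_smul] at h
  rw [eq_sub_of_add_eq h]
  module

end ResolventIdentity

/-! ### The bounded operators `G` and `B* G`. -/

section Resolvent

variable {H K : Type*}
  [NormedAddCommGroup H] [InnerProductSpace ℂ H] [CompleteSpace H]
  [NormedAddCommGroup K] [InnerProductSpace ℂ K] [CompleteSpace K]
  {T : H →ₗ.[ℂ] H} {B : K →ₗ.[ℂ] H}

/-- `(T - μ)⁻¹ B` extends to a bounded operator, whose adjoint is `B* (T - μ)⁻¹`. -/
lemma exists_resolvent_comp (hT : IsSelfAdjoint T) (hB : Dense (B.domain : Set K))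
    (hrel : IsRelBounded B.adjoint T) {μ : ℝ} {R : H →L[ℂ] H}
    (hR : IsBoundedInverse (T - scalarOp H (μ : ℂ)) R) :
    ∃ G : K →L[ℂ] H, (∀ v (hv : v ∈ B.domain), G v = R (B ⟨v, hv⟩)) ∧
      ∀ w (hw : w ∈ T.domain), ∃ hw' : w ∈ B.adjoint.domain,
        B.adjoint ⟨w, hw'⟩ = G.adjoint (T ⟨w, hw⟩ - (μ : ℂ) • w) := by
  obtain ⟨hle, a, b, ha, hb, hab⟩ := hrel
  -- `C` is `B* R`, bounded because `B*` is `T`-bounded. Its adjoint is the required `G`.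
  obtain ⟨C, hC⟩ := exists_bounded_comp (C := a * ‖R‖ + b * (1 + |μ| * ‖R‖))
    (LinearPMap.adjoint_isClosed hB) R
    (p := ⊤) dense_univ (fun y _ => by
      refine ⟨hle (hR.mem_of_sub y), (hab ⟨R y, hR.mem_of_sub y⟩).trans ?_⟩
      rw [hR.apply_of_sub]
      have h1 := R.le_opNorm y
      have h2 : ‖y + (μ : ℂ) • R y‖ ≤ ‖y‖ + |μ| * (‖R‖ * ‖y‖) := by
        refine (norm_add_le _ _).trans ?_
        rw [norm_smul, Complex.norm_real, Real.norm_eq_abs]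
        gcongr
      calc a * ‖R y‖ + b * ‖y + (μ : ℂ) • R y‖
          ≤ a * (‖R‖ * ‖y‖) + b * (‖y‖ + |μ| * (‖R‖ * ‖y‖)) := by gcongr
        _ = _ := by ring)
  refine ⟨C.adjoint, fun v hv => ?_, fun w hw => ?_⟩
  · refine ext_inner_right ℂ fun y => ?_
    obtain ⟨-, h1, h2⟩ := hC y
    rw [ContinuousLinearMap.adjoint_inner_left, ← h2, hR.symmetric (isSelfAdjoint_sub_scalarOp hT μ),
      ← inner_conj_symm, inner_adjoint hB h1 hv, inner_conj_symm]
  · refine ⟨hle hw, ?_⟩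
    obtain ⟨-, h1, h2⟩ := hC (T ⟨w, hw⟩ - (μ : ℂ) • w)
    rw [ContinuousLinearMap.adjoint_adjoint, ← h2]
    simp only [hR.apply_left_of_sub w hw]

/-- `B* G` is bounded and symmetric, where `G` is the closure of `(T - μ)⁻¹ B`. -/
lemma exists_adjoint_comp (hT : IsSelfAdjoint T) (hB : Dense (B.domain : Set K)) {μ : ℝ}
    {R : H →L[ℂ] H} (hR : IsBoundedInverse (T - scalarOp H (μ : ℂ)) R) {G : K →L[ℂ] H}
    (hG : ∀ v (hv : v ∈ B.domain), G v = R (B ⟨v, hv⟩)) {C : ℝ} (hC : 0 ≤ C)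
    (hform : ∀ u (hu : u ∈ T.domain), ∃ hu' : u ∈ B.adjoint.domain,
      ‖B.adjoint ⟨u, hu'⟩‖ ^ 2 ≤ C * ((⟪T ⟨u, hu⟩, u⟫_ℂ).re - μ * ‖u‖ ^ 2)) :
    ∃ W : K →L[ℂ] K, (∀ v, ∃ hv : G v ∈ B.adjoint.domain, B.adjoint ⟨G v, hv⟩ = W v) ∧
      ∀ x y, ⟪W x, y⟫_ℂ = ⟪x, W y⟫_ℂ := by
  obtain ⟨W, hW⟩ := exists_bounded_comp (C := C) (LinearPMap.adjoint_isClosed hB) G hB (by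
    intro v hv
    have hGT : G v ∈ T.domain := by rw [hG v hv]; exact hR.mem_of_sub _
    obtain ⟨h1, h2⟩ := hform (G v) hGT
    refine ⟨h1, ?_⟩
    have h3 : T ⟨G v, hGT⟩ = B ⟨v, hv⟩ + (μ : ℂ) • G v := by
      simp only [hG v hv]
      exact hR.apply_of_sub _ _
    -- Since `(T - μ) G v = B v`, the form at `G v` equals `Re ⟨B* G v, v⟩`. The hypothesis becomes
    -- `‖B* G v‖² ≤ C ‖B* G v‖ ‖v‖`, and one factor cancels.
    have h4 : (⟪T ⟨G v, hGT⟩, G v⟫_ℂ).re - μ * ‖G v‖ ^ 2 =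
        (⟪B.adjoint ⟨G v, h1⟩, v⟫_ℂ).re := by
      have h5 : (⟪G v, G v⟫_ℂ).re = ‖G v‖ ^ 2 := inner_self_eq_norm_sq (𝕜 := ℂ) _
      rw [inner_adjoint hB h1 hv, h3, inner_add_left, inner_smul_left, Complex.conj_ofReal,
        Complex.add_re, Complex.re_ofReal_mul, h5, add_sub_cancel_right, ← inner_conj_symm,
        Complex.conj_re]
    rw [h4] at h2
    have h6 : (⟪B.adjoint ⟨G v, h1⟩, v⟫_ℂ).re ≤ ‖B.adjoint ⟨G v, h1⟩‖ * ‖v‖ :=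
      re_inner_le_norm (𝕜 := ℂ) _ _
    rcases (norm_nonneg (B.adjoint ⟨G v, h1⟩)).eq_or_lt with h0 | h0
    · rw [← h0]; positivity
    · have h7 := h2.trans (mul_le_mul_of_nonneg_left h6 hC)
      nlinarith)
  refine ⟨W, fun v => (hW v).2, ?_⟩
  -- On `dom B` both sides equal `⟨R B x, B y⟩`, up to symmetry of `R`.
  have hdense : ∀ x ∈ B.domain, ∀ y ∈ B.domain, ⟪W x, y⟫_ℂ = ⟪x, W y⟫_ℂ := by
    intro x hx y hy
    obtain ⟨-, h1, h2⟩ := hW x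
    obtain ⟨-, h3, h4⟩ := hW y
    rw [← h2, ← h4, inner_adjoint hB h1 hy, ← inner_conj_symm x, inner_adjoint hB h3 hx,
      inner_conj_symm, hG x hx, hG y hy, hR.symmetric (isSelfAdjoint_sub_scalarOp hT μ)]
  intro x y
  have hc1 : ∀ y ∈ B.domain, IsClosed {x : K | ⟪W x, y⟫_ℂ = ⟪x, W y⟫_ℂ} := fun y _ =>
    isClosed_eq (by fun_prop) (by fun_prop)
  have hc2 : IsClosed {y : K | ⟪W x, y⟫_ℂ = ⟪x, W y⟫_ℂ} :=
    isClosed_eq (by fun_prop) (by fun_prop)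
  exact hc2.closure_subset_iff.2 (fun y hy =>
    (hc1 y hy).closure_subset_iff.2 (fun x hx => hdense x hx y hy) (hB x)) (hB y)

end Resolvent

/-! ### The block matrix, its linearization and its closure. -/

section Block

variable {H K : Type*}
  [NormedAddCommGroup H] [InnerProductSpace ℂ H]
  [NormedAddCommGroup K] [InnerProductSpace ℂ K]

variable (H K) in
/-- The bounded diagonal operator `diag(a, b)`. -/
noncomputable def diagCLM (a b : ℂ) : WithLp 2 (H × K) →L[ℂ] WithLp 2 (H × K) :=
  (WithLp.prodContinuousLinearEquiv 2 ℂ H K).symm.toContinuousLinearMap ∘L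
    ((a • WithLp.fstL 2 ℂ H K).prod (b • WithLp.sndL 2 ℂ H K))

lemma opBlock_diag_eq (a b : ℂ) : opBlock (scalarOp H a) 0 0 (scalarOp K b) =
    (diagCLM H K a b : WithLp 2 (H × K) →ₗ[ℂ] WithLp 2 (H × K)).toPMap ⊤ := by
  refine LinearPMap.ext (eq_top_iff.2 fun x _ => ⟨⟨trivial, trivial⟩, trivial, trivial⟩) ?_
  intro x h1 h2
  change WithLp.toLp 2 (a • x.fst + 0, 0 + b • x.snd) = WithLp.toLp 2 (a • x.fst, b • x.snd)
  rw [add_zero, zero_add]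

variable [CompleteSpace K] {Ta : H →ₗ.[ℂ] H} {B : K →ₗ.[ℂ] H} {D : K →ₗ.[ℂ] K}

lemma mem_opA_domain {u : H} {v : K} : WithLp.toLp 2 (u, v) ∈ (opA Ta B D).domain ↔
    (u ∈ Ta.domain ∧ v ∈ B.domain) ∧ u ∈ B.adjoint.domain ∧ v ∈ D.domain := Iff.rfl

lemma opA_apply {u : H} {v : K} (h : WithLp.toLp 2 (u, v) ∈ (opA Ta B D).domain) :
    opA Ta B D ⟨WithLp.toLp 2 (u, v), h⟩ = WithLp.toLp 2
      (Ta ⟨u, h.1.1⟩ + B ⟨v, h.1.2⟩, B.adjoint ⟨u, h.2.1⟩ + D ⟨v, h.2.2⟩) := rfl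

lemma opP_eq (z : ℂ) : opP Ta B D z =
    opA Ta B D + (diagCLM H K (z ^ 2) z : WithLp 2 (H × K) →ₗ[ℂ] WithLp 2 (H × K)).toPMap ⊤ := by
  refine LinearPMap.ext (le_antisymm ?_ ?_) ?_
  · exact fun x hx => ⟨⟨⟨hx.1.1.1, hx.1.2⟩, hx.2.1, hx.2.2.1⟩, trivial⟩
  · exact fun x hx =>
      ⟨⟨⟨hx.1.1.1, trivial⟩, hx.1.1.2⟩, hx.1.2.1, ⟨hx.1.2.2, trivial⟩⟩
  · intro x h1 h2
    change WithLp.toLp 2 (Ta ⟨x.fst, h2.1.1.1⟩ + z ^ 2 • x.fst + B ⟨x.snd, h2.1.1.2⟩,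
        B.adjoint ⟨x.fst, h2.1.2.1⟩ + (D ⟨x.snd, h2.1.2.2⟩ + z • x.snd)) =
      WithLp.toLp 2 (Ta ⟨x.fst, h2.1.1.1⟩ + B ⟨x.snd, h2.1.1.2⟩,
        B.adjoint ⟨x.fst, h2.1.2.1⟩ + D ⟨x.snd, h2.1.2.2⟩) +
      WithLp.toLp 2 (z ^ 2 • x.fst, z • x.snd)
    rw [← WithLp.toLp_add, Prod.mk_add_mk, add_right_comm, add_assoc (B.adjoint _)]

/-- The linearized operator function is closable as soon as the block matrix is. -/
lemma isClosable_opTt (hA : (opA Ta B D).IsClosable) (z : ℂ) : (opTt Ta B D z).IsClosable := by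
  refine isClosable_of_forall fun y hy => ?_
  let X := WithLp 2 (H × WithLp 2 (H × K))
  -- `Φ` recovers a point of the graph of `𝒜` from rows one and three. Row two is a bounded relation
  -- and is handled separately by `h2`.
  let Φ : X × X → WithLp 2 (H × K) × WithLp 2 (H × K) := fun p =>
    (p.1.snd, WithLp.toLp 2 (-p.2.fst - z • p.1.fst, p.2.snd.snd - z • p.1.snd.snd))
  have hΦ : Continuous Φ := by
    refine Continuous.prodMk (by fun_prop) (continuous_toLp_pair ?_ ?_) <;> fun_prop
  have h1 : Φ (0, y) ∈ (opA Ta B D).closure.graph := by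
    rw [mem_closure_graph_iff hA]
    refine closure_mono ?_ (image_closure_subset_closure_image hΦ ⟨_, hy, rfl⟩)
    rintro _ ⟨⟨_, _⟩, hp, rfl⟩
    obtain ⟨⟨x, hx⟩, rfl, rfl⟩ := (LinearPMap.mem_graph_iff _).1 hp
    obtain ⟨⟨-, hu, hv⟩, ⟨-, -, -⟩, -, hu', hv', -⟩ := hx
    refine (LinearPMap.mem_graph_iff _).2 ⟨⟨x.snd, ⟨hu, hv⟩, hu', hv'⟩, rfl, ?_⟩
    change WithLp.toLp 2 (Ta ⟨x.snd.fst, hu⟩ + B ⟨x.snd.snd, hv⟩,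
        B.adjoint ⟨x.snd.fst, hu'⟩ + D ⟨x.snd.snd, hv'⟩) =
      WithLp.toLp 2 (-((-z) • x.fst + (-Ta ⟨x.snd.fst, hu⟩ + -B ⟨x.snd.snd, hv⟩)) - z • x.fst,
        0 + (B.adjoint ⟨x.snd.fst, hu'⟩ + (D ⟨x.snd.snd, hv'⟩ + z • x.snd.snd)) - z • x.snd.snd)
    congr 2
    · module
    · module
  have h2 : IsClosed {p : X × X | p.2.snd.fst = p.1.fst - z • p.1.snd.fst} :=
    isClosed_eq (by fun_prop) (by fun_prop)
  have h3 : y.snd.fst = (0 : X).fst - z • (0 : X).snd.fst := by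
    refine h2.closure_subset_iff.2 ?_ hy
    rintro ⟨_, _⟩ hp
    obtain ⟨⟨x, hx⟩, rfl, rfl⟩ := (LinearPMap.mem_graph_iff _).1 hp
    change (1 : ℂ) • x.fst + ((-z) • x.snd.fst + 0) = x.fst - z • x.snd.fst
    module
  have h4 : (Φ (0, y)).2 = 0 := (opA Ta B D).closure.graph_fst_eq_zero_snd h1 rfl
  have h5 : -y.fst - z • (0 : H) = 0 := congrArg WithLp.fst h4
  have h6 : y.snd.snd - z • (0 : K) = 0 := congrArg WithLp.snd h4
  have h7 : y.snd.fst = (0 : H) - z • (0 : H) := h3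
  rw [smul_zero, sub_zero] at h5 h6 h7
  have h8 : y = WithLp.toLp 2 (y.fst, WithLp.toLp 2 (y.snd.fst, y.snd.snd)) := rfl
  rw [h8, neg_eq_zero.1 h5, h6, h7]
  rfl

variable [CompleteSpace H] {G : K →L[ℂ] H} {W : K →L[ℂ] K} {μ : ℝ}

/-- Write `u = (u + G v) - G v`: both terms lie in `dom B*`, even when `u` is not in `dom Ta`. This
identifies the second component of `schurOp` with `B* u + D v`. -/
lemma adjoint_sub_apply
    (hGadj : ∀ w (hw : w ∈ Ta.domain), ∃ hw' : w ∈ B.adjoint.domain,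
      B.adjoint ⟨w, hw'⟩ = G.adjoint (Ta ⟨w, hw⟩ - (μ : ℂ) • w))
    (hW : ∀ v, ∃ hv : G v ∈ B.adjoint.domain, B.adjoint ⟨G v, hv⟩ = W v)
    {u : H} {v : K} (hw : u + G v ∈ Ta.domain) :
    ∃ hu : u ∈ B.adjoint.domain, B.adjoint ⟨u, hu⟩ =
      G.adjoint (Ta ⟨u + G v, hw⟩ - (μ : ℂ) • (u + G v)) - W v := by
  obtain ⟨h1, h2⟩ := hGadj _ hw
  obtain ⟨h3, h4⟩ := hW v
  have h5 := B.adjoint.map_sub ⟨_, h1⟩ ⟨_, h3⟩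
  rw [h2, h4] at h5
  have hu : u ∈ B.adjoint.domain := by
    have := B.adjoint.domain.sub_mem h1 h3
    rwa [add_sub_cancel_right] at this
  refine ⟨hu, ?_⟩
  rw [← h5]
  congr 1
  exact Subtype.ext (add_sub_cancel_right u (G v)).symm

/-- The closure of the block matrix is given by its Frobenius–Schur factorization. -/
lemma closure_opA_eq_schurOp (hTa : IsSelfAdjoint Ta) (hD : IsSelfAdjoint D)
    (hcore : D.HasCore B.domain)
    {R : H →L[ℂ] H} (hR : IsBoundedInverse (Ta - scalarOp H (μ : ℂ)) R)
    (hG : ∀ v (hv : v ∈ B.domain), G v = R (B ⟨v, hv⟩))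
    (hGadj : ∀ w (hw : w ∈ Ta.domain), ∃ hw' : w ∈ B.adjoint.domain,
      B.adjoint ⟨w, hw'⟩ = G.adjoint (Ta ⟨w, hw⟩ - (μ : ℂ) • w))
    (hW : ∀ v, ∃ hv : G v ∈ B.adjoint.domain, B.adjoint ⟨G v, hv⟩ = W v)
    (hWsymm : ∀ x y, ⟪W x, y⟫_ℂ = ⟪x, W y⟫_ℂ) :
    (opA Ta B D).IsClosable ∧ (opA Ta B D).closure = schurOp Ta D G W (μ : ℂ) := by
  have hGT : ∀ v (hv : v ∈ B.domain), ∃ h : G v ∈ Ta.domain,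
      Ta ⟨G v, h⟩ = B ⟨v, hv⟩ + (μ : ℂ) • G v := by
    intro v hv
    have h1 := hR.mem_of_sub (B ⟨v, hv⟩)
    have h2 := hR.apply_of_sub (B ⟨v, hv⟩) h1
    rw [← hG v hv] at h1
    simp only [← hG v hv] at h2
    exact ⟨h1, h2⟩
  have hM : (schurOp Ta D G W (μ : ℂ)).IsClosed :=
    (isSelfAdjoint_schurOp hTa hD hWsymm μ).isClosed
  have hle : opA Ta B D ≤ schurOp Ta D G W (μ : ℂ) := by
    have hd : ∀ x ∈ (opA Ta B D).domain, x ∈ (schurOp Ta D G W (μ : ℂ)).domain := by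
      rintro x ⟨⟨hu, hv⟩, -, hv'⟩
      exact ⟨hv', Ta.domain.add_mem hu (hGT _ hv).choose⟩
    refine ⟨hd, ?_⟩
    rintro ⟨x, hx⟩ ⟨_, hx'⟩ rfl
    have hx1 : WithLp.toLp 2 (x.fst, x.snd) ∈ (opA Ta B D).domain := hx
    have hx2 : WithLp.toLp 2 (x.fst, x.snd) ∈ (schurOp Ta D G W (μ : ℂ)).domain := hx'
    change opA Ta B D ⟨WithLp.toLp 2 (x.fst, x.snd), hx1⟩ =
      schurOp Ta D G W (μ : ℂ) ⟨WithLp.toLp 2 (x.fst, x.snd), hx2⟩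
    obtain ⟨h1, h2⟩ := hGT x.snd hx1.1.2
    have hw : x.fst + G x.snd ∈ Ta.domain := hx2.2
    obtain ⟨h3, h4⟩ := adjoint_sub_apply hGadj hW hw
    rw [opA_apply, schurOp_apply, ← h4]
    have h5 : Ta ⟨x.fst + G x.snd, hx2.2⟩ = Ta ⟨x.fst, hx1.1.1⟩ + Ta ⟨G x.snd, h1⟩ :=
      Ta.map_add ⟨x.fst, hx1.1.1⟩ ⟨G x.snd, h1⟩
    rw [h5, h2, ← add_assoc, add_sub_cancel_right]
  have hc := hM.isClosable.leIsClosable hle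
  refine ⟨hc, le_antisymm ?_ (LinearPMap.le_of_le_graph ?_)⟩
  · have := hM.isClosable.closure_mono hle
    rwa [closure_eq_of_isClosed hM] at this
  · rintro ⟨_, _⟩ hp
    obtain ⟨⟨x, hx⟩, rfl, rfl⟩ := (LinearPMap.mem_graph_iff _).1 hp
    rw [mem_closure_graph_iff hc]
    obtain ⟨hv, hw⟩ := mem_schurOp_domain.1 hx
    set w := x.fst + G x.snd with hwdef
    -- With `w` fixed and only `v` varying, `Φ` is continuous and carries the graph of `D`
    -- restricted to `dom B` into the graph of `𝒜`. The core property then reaches every `v ∈ dom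
    -- D`.
    let Φ : K × K → WithLp 2 (H × K) × WithLp 2 (H × K) := fun p =>
      (WithLp.toLp 2 (w - G p.1, p.1), WithLp.toLp 2
        (Ta ⟨w, hw⟩ - (μ : ℂ) • G p.1,
          G.adjoint (Ta ⟨w, hw⟩ - (μ : ℂ) • w) - W p.1 + p.2))
    have hΦ : Continuous Φ := by
      refine Continuous.prodMk (continuous_toLp_pair ?_ ?_) (continuous_toLp_pair ?_ ?_) <;> fun_prop
    have hmem : (x.snd, D ⟨x.snd, hv⟩) ∈ closure ((D.domRestrict B.domain).graph : Set (K × K)) := by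
      rw [← mem_closure_graph_iff (hD.isClosed.isClosable.leIsClosable LinearPMap.domRestrict_le),
        hcore.closure_eq]
      exact D.mem_graph ⟨x.snd, hv⟩
    have himg : Φ (x.snd, D ⟨x.snd, hv⟩) = (x, schurOp Ta D G W (μ : ℂ) ⟨x, hx⟩) := by
      have h1 : WithLp.toLp 2 (w - G x.snd, x.snd) = x := by
        rw [hwdef, add_sub_cancel_right]; rfl
      exact Prod.ext h1 rfl
    rw [← himg]
    refine closure_mono ?_ (image_closure_subset_closure_image hΦ ⟨_, hmem, rfl⟩)
    rintro _ ⟨⟨_, _⟩, hp, rfl⟩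
    obtain ⟨⟨v, hvB, hvD⟩, rfl, rfl⟩ := (LinearPMap.mem_graph_iff _).1 hp
    obtain ⟨h1, -⟩ := hGT v hvB
    have hu : w - G v ∈ Ta.domain := Ta.domain.sub_mem hw h1
    have hA : WithLp.toLp 2 (w - G v, v) ∈ (opA Ta B D).domain :=
      mem_opA_domain.2 ⟨⟨hu, hvB⟩, (hGadj _ hu).choose, hvD⟩
    refine (LinearPMap.mem_graph_iff _).2 ⟨⟨_, hA⟩, rfl, ?_⟩
    rw [hle.2 (x := ⟨_, hA⟩) (y := ⟨_, hle.1 hA⟩) rfl, schurOp_apply_sub _ hw hvD]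
    rfl

end Block

end BlockOp

/-! ### The main theorem. -/

theorem theorem3p1 {H K : Type*}
    [NormedAddCommGroup H] [InnerProductSpace ℂ H] [CompleteSpace H]
    [NormedAddCommGroup K] [InnerProductSpace ℂ K] [CompleteSpace K]
    (Ta : H →ₗ.[ℂ] H) (B : K →ₗ.[ℂ] H) (D : K →ₗ.[ℂ] K) (η : ℝ)
    (hTa : IsSelfAdjoint Ta) (hη : BlockOp.IsBoundedBelow Ta η)
    (hD : IsSelfAdjoint D)
    (hBdense : Dense (B.domain : Set K)) (hBclosed : B.IsClosed)
    (hBD : B.domain ≤ D.domain) (hcore : D.HasCore B.domain)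
    (hdom : (BlockOp.sqrtAbsOp Ta).domain ≤ B.adjoint.domain) :
    -- both operator functions are closable
    (∀ z : ℂ, (BlockOp.opP Ta B D z).IsClosable) ∧
    (∀ z : ℂ, (BlockOp.opTt Ta B D z).IsClosable) ∧
    -- the block matrix is upper dominant and its closure is self-adjoint
    BlockOp.IsRelBounded B.adjoint Ta ∧ BlockOp.IsRelBounded D B ∧
    (BlockOp.opA Ta B D).IsClosable ∧ IsSelfAdjoint (BlockOp.opA Ta B D).closure ∧
    -- the closure of `P(z)` is that closure plus the bounded operator `diag(z², z)`
    (∀ z : ℂ, (BlockOp.opP Ta B D z).closure =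
      (BlockOp.opA Ta B D).closure +
        BlockOp.opBlock (BlockOp.scalarOp H (z ^ 2)) 0 0 (BlockOp.scalarOp K z)) ∧
    -- all real `μ < η` are in the resolvent set of `Ta`
    (∀ μ : ℝ, μ < η → ∃ R : H →L[ℂ] H,
      BlockOp.IsBoundedInverse (Ta - BlockOp.scalarOp H (μ : ℂ)) R) ∧
    -- explicit form of the closure, with `R = (Ta - μ)⁻¹` and `G` the closure of `R B`
    (∀ (μ : ℝ) (R : H →L[ℂ] H),
      BlockOp.IsBoundedInverse (Ta - BlockOp.scalarOp H (μ : ℂ)) R →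
      ((R : H →ₗ[ℂ] H).compPMap B).IsClosable ∧
      ∃ G : K →L[ℂ] H,
        ((R : H →ₗ[ℂ] H).compPMap B).closure = (G : K →ₗ[ℂ] H).toPMap ⊤ ∧
        (∀ (u : H) (v : K), WithLp.toLp 2 (u, v) ∈ (BlockOp.opA Ta B D).closure.domain ↔
          v ∈ D.domain ∧ u + G v ∈ Ta.domain) ∧
        ∀ (u : H) (v : K) (hv : v ∈ D.domain) (hw : u + G v ∈ Ta.domain),
          ∃ (hu : u ∈ B.adjoint.domain)
            (hx : WithLp.toLp 2 (u, v) ∈ (BlockOp.opA Ta B D).closure.domain),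
            (BlockOp.opA Ta B D).closure ⟨WithLp.toLp 2 (u, v), hx⟩ =
              WithLp.toLp 2
                (Ta ⟨u + G v, hw⟩ - (μ : ℂ) • G v, B.adjoint ⟨u, hu⟩ + D ⟨v, hv⟩)) := by
  obtain ⟨C, hC, hform⟩ := BlockOp.exists_form_bound hTa hη
    (LinearPMap.adjoint_isClosed hBdense) hdom
  have hrel : BlockOp.IsRelBounded B.adjoint Ta :=
    BlockOp.isRelBounded_of_isClosed (LinearPMap.adjoint_isClosed hBdense) hTa.isClosed
      fun u hu => (hform u hu).choose
  have hres : ∀ μ : ℝ, μ < η → ∃ R : H →L[ℂ] H,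
      BlockOp.IsBoundedInverse (Ta - BlockOp.scalarOp H (μ : ℂ)) R := fun μ hμ =>
    BlockOp.exists_isBoundedInverse (BlockOp.isSelfAdjoint_sub_scalarOp hTa μ) (sub_pos.2 hμ)
      (BlockOp.isBoundedBelow_sub hη μ)
  -- The point `η - 1` matches the shift in the form bound.
  obtain ⟨S, hS⟩ := hres (η - 1) (by linarith)
  obtain ⟨J, hJ, hJadj⟩ := BlockOp.exists_resolvent_comp hTa hBdense hrel hS
  obtain ⟨W, hW, hWsymm⟩ := BlockOp.exists_adjoint_comp hTa hBdense hS hJ hC hform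
  obtain ⟨hA, hAcl⟩ := BlockOp.closure_opA_eq_schurOp hTa hD hcore hS hJ hJadj hW hWsymm
  refine ⟨fun z => ?_, BlockOp.isClosable_opTt hA, hrel,
    BlockOp.isRelBounded_of_isClosed hD.isClosed hBclosed hBD, hA, ?_, fun z => ?_, hres, ?_⟩
  · rw [BlockOp.opP_eq]
    exact (BlockOp.closure_add_bounded hA _).1
  · rw [hAcl]
    exact BlockOp.isSelfAdjoint_schurOp hTa hD hWsymm (η - 1)
  · rw [BlockOp.opP_eq, BlockOp.opBlock_diag_eq]
    exact (BlockOp.closure_add_bounded hA _).2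
  intro μ R hR
  obtain ⟨G, hG, -⟩ := BlockOp.exists_resolvent_comp hTa hBdense hrel hR
  obtain ⟨hcl, hcl'⟩ := BlockOp.closure_of_dense_bounded
    (f := (R : H →ₗ[ℂ] H).compPMap B) (L := G) hBdense fun v => (hG v v.2).symm
  have hsub := BlockOp.resolvent_comp_sub hBdense hR hS hG hJ
  -- `G v` and `J v` differ by a multiple of `R (J v)`, which lies in `dom Ta`.
  have hmem : ∀ (u : H) (v : K), u + J v ∈ Ta.domain ↔ u + G v ∈ Ta.domain := by
    intro u v
    rw [hsub v, ← add_assoc]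
    exact (Submodule.add_mem_iff_left _ (Ta.domain.smul_mem _ (hR.mem_of_sub _))).symm
  refine ⟨hcl, G, hcl', fun u v => ?_, fun u v hv hw => ?_⟩
  · rw [hAcl, ← hmem u v]
    exact BlockOp.mem_schurOp_domain
  · have hw' := (hmem u v).2 hw
    have hx : WithLp.toLp 2 (u, v) ∈
        (BlockOp.schurOp Ta D J W ((η - 1 : ℝ) : ℂ)).domain := ⟨hv, hw'⟩
    obtain ⟨hu, hBu⟩ := BlockOp.adjoint_sub_apply hJadj hW hw'
    have hRJ := hR.mem_of_sub (J v)
    have hTw : Ta ⟨u + G v, hw⟩ =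
        Ta ⟨u + J v, hw'⟩ + ((μ : ℂ) - ((η - 1 : ℝ) : ℂ)) • Ta ⟨R (J v), hRJ⟩ := by
      rw [← Ta.map_smul, ← Ta.map_add]
      congr 1
      refine Subtype.ext ?_
      change u + G v = u + J v + ((μ : ℂ) - ((η - 1 : ℝ) : ℂ)) • R (J v)
      rw [hsub v, add_assoc]
    -- The first component does not depend on the spectral parameter, because `Ta R J v = J v + μ R
    -- J v`.
    have hfst : Ta ⟨u + G v, hw⟩ - (μ : ℂ) • G v =
        Ta ⟨u + J v, hw'⟩ - ((η - 1 : ℝ) : ℂ) • J v := by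
      rw [hTw, hR.apply_of_sub, hsub v]
      module
    rw [hAcl]
    refine ⟨hu, hx, ?_⟩
    rw [BlockOp.schurOp_apply hx, hfst, hBu]
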